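/- Let $G=(V,E)$ be a finite connected (simple) graph with $n=|V|$ vertices, $m=|E|\ge 1$ edges and maximum degree $\Delta$; let $d(v)$ denote the degree of $v\in V$ in $G$. Let $\beta>0$ and $x=\tanh\beta$. For $A\subseteq E$ let $\partial A\subseteq V$ be the set of vertices of odd degree in the spanning subgraph $(V,A)$. Let $\mathcal C_k=\{A\subseteq E: |\partial A|=k\}$ and $\mathcal W=\mathcal C_0\cup\mathcal C_2$. The Prokof'ev–Svistunov measure is the probability measure on $\mathcal W$ given by $$\pi_x(A)=\frac{x^{|A|}\psi(A)}{n\sum_{B\in\mathcal C_0}x^{|B|}+2\sum_{B\in\mathcal C_2}x^{|B|}},\qquad \psi(A)=n\text{ if }A\in\mathcal C_0,\quad \psi(A)=2\text{ if }A\in\mathcal C_2 .$$ The worm process for the zero-field ferromagnetic Ising model on $G$ at inverse temperature $\beta$ is the Markov chain on $\mathcal W$ with transition matrix $P_x$, where, for each edge $uv\in E$ and $A\in\mathcal W$ with $A\triangle uv\in\mathcal W$, $$P_x(A,A\triangle uv)=\begin{cases}x^{\mathbf 1(uv\notin A)}\frac1{2n}\left(\frac1{d(u)}+\frac1{d(v)}\right),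 & A\in\mathcal C_0,\\[1mm] x^{\mathbf 1(uv\notin A)}\frac14\left(\frac1{d(u)}+\frac1{d(v)}\right), & A\triangle uv\in\mathcal C_0,\\[1mm] \min\left(\frac{d(u)}{d(v)}x^{\mathbf 1(uv\notin A)-\mathbf 1(uv\in A)},1\right)\frac1{4d(u)}, & A,\ A\triangle uv\in\mathcal C_2,\ u\in\partial A,\end{cases}$$ all other off-diagonal entries are $0$, and the diagonal entries are such that the rows sum to $1$. (This is the lazy Metropolis chain, reversible with respect to $\pi_x$.) Let $\lambda_\star$ be the maximum absolute value of the non-trivial eigenvalues of $P_x$, and let $t_{\mathrm{rel}}=1/(1-\lambda_\star)$ be the relaxation time. For $\delta\in(0,1)$ and $A\in\mathcal W$ let $t_{\mathrm{mix}}(A,\delta)=\min\{t\in\mathbb N:\|P_x^t(A,\cdot)-\pi_x\|\le\delta\}$, where $\|\cdot\|$ is the total variation distance, and let $t_{\mathrm{mix}}(\delta)=\max_{A\in\mathcal W}t_{\mathrm{mix}}(A,\delta)$. Write $\mathbf 0$ for the empty set of edges. Then $\lambda_\star<1$ and $$t_{\mathrm{rel}}\le 4\,\Delta\,m\,n^4,$$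 and, for every $\delta\in(0,1)$, the mixing times are well defined (the minimum exists for every $A\in\mathcal W$) and satisfy $$t_{\mathrm{mix}}(\mathbf 0,\delta)\le 4\left[\log 2+\frac{\log(\delta^{-1})}{m}\right]\Delta\,m^2\,n^4,$$ $$t_{\mathrm{mix}}(\delta)\le 4\left[\log\left(\frac2x\right)+\frac{\log(2\delta^{-1})}{m}\right]\Delta\,m^2\,n^4 .$$ -/

import Mathlib

open Finset

noncomputable section

/-! ### Finite Markov chains -/

section MarkovChain

variable {Ω : Type*} [Fintype Ω]

/-- Total variation distance of two probability vectors on a finite set. -/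
def tvDist (μ ν : Ω → ℝ) : ℝ := (1 / 2) * ∑ ω, |μ ω - ν ω|

/-- The non-trivial eigenvalues of a stochastic matrix `P` reversible with respect to a positive
distribution (all its eigenvalues are then real): those with an eigenfunction that is not constant.
The constant functions always account for one copy of the eigenvalue `1`; a further copy of `1`
counts as non-trivial, and there is one exactly when `P` is not irreducible. -/
def nontrivialEigenvalues (P : Matrix Ω Ω ℝ) : Set ℝ :=
  {μ | ∃ f : Ω → ℝ, (¬ ∃ c : ℝ, ∀ ω, f ω = c) ∧ P.mulVec f = μ • f}

/-- The largest absolute value of a non-trivial eigenvalue. -/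
def lambdaStar (P : Matrix Ω Ω ℝ) : ℝ := sSup ((fun μ => |μ|) '' nontrivialEigenvalues P)

/-- The relaxation time, the reciprocal of the absolute spectral gap. -/
def relaxationTime (P : Matrix Ω Ω ℝ) : ℝ := 1 / (1 - lambdaStar P)

variable [DecidableEq Ω]

/-- The times at which the chain started in `ω` is within `δ` of `π`. -/
def mixedTimes (P : Matrix Ω Ω ℝ) (π : Ω → ℝ) (ω : Ω) (δ : ℝ) : Set ℕ :=
  {t | tvDist ((P ^ t) ω) π ≤ δ}

/-- The mixing time from the state `ω` (the least element of `mixedTimes`, if there is any). -/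
def mixingTimeFrom (P : Matrix Ω Ω ℝ) (π : Ω → ℝ) (ω : Ω) (δ : ℝ) : ℕ :=
  sInf (mixedTimes P π ω δ)

/-- The mixing time: the maximum of the mixing times over all initial states. -/
def mixingTime (P : Matrix Ω Ω ℝ) (π : Ω → ℝ) (δ : ℝ) : ℕ :=
  univ.sup fun ω => mixingTimeFrom P π ω δ

end MarkovChain

/-! ### The Prokof'ev-Svistunov measure and the worm process -/

section Worm

variable {V : Type*} [Fintype V] [DecidableEq V]

/-- `∂A`: the vertices of odd degree in the spanning subgraph with edge set `A`. -/
def oddVertices (A : Finset (Sym2 V)) : Finset V :=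
  {v | Odd #{u : V | s(u, v) ∈ A}}

variable (G : SimpleGraph V) [DecidableRel G.Adj]

/-- `𝒞ₖ`: the sets of edges of `G` with exactly `k` odd vertices. -/
def oddClass (k : ℕ) : Finset (Finset (Sym2 V)) :=
  {A ∈ G.edgeFinset.powerset | #(oddVertices A) = k}

/-- The configuration space `𝒲 = 𝒞₀ ∪ 𝒞₂`. -/
abbrev WormState : Type _ := {A : Finset (Sym2 V) // A ∈ oddClass G 0 ∪ oddClass G 2}

/-- The state `𝟎`, the empty set of edges. -/
def emptyState : WormState G := ⟨∅, by simp [oddClass, oddVertices]⟩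

/-- The weight `λ_x(S) = ∑_{A ∈ S} x^{|A|}`. -/
def edgeWeight (x : ℝ) (S : Finset (Finset (Sym2 V))) : ℝ := ∑ A ∈ S, x ^ #A

/-- The Prokof'ev-Svistunov measure `π_x`. -/
def psMeasure (x : ℝ) (A : WormState G) : ℝ :=
  x ^ #A.1 * (if A.1 ∈ oddClass G 0 then (Fintype.card V : ℝ) else 2) /
    (Fintype.card V * edgeWeight x (oddClass G 0) + 2 * edgeWeight x (oddClass G 2))

/-- The probability of the transition `A ↦ A ∆ e` of the worm process, for an edge `e = uv`.
In the third case exactly one endpoint `u` of `e` is an odd vertex of `A`, so that the double sum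
has exactly one term. -/
def wormRate (x : ℝ) (A : Finset (Sym2 V)) (e : Sym2 V) : ℝ :=
  if A ∈ oddClass G 0 then
    (if e ∈ A then 1 else x) * (1 / (2 * Fintype.card V)) * ∑ w ∈ e.toFinset, 1 / (G.degree w : ℝ)
  else if symmDiff A {e} ∈ oddClass G 0 then
    (if e ∈ A then 1 else x) * (1 / 4) * ∑ w ∈ e.toFinset, 1 / (G.degree w : ℝ)
  else if A ∈ oddClass G 2 ∧ symmDiff A {e} ∈ oddClass G 2 then
    ∑ u ∈ e.toFinset ∩ oddVertices A, ∑ v ∈ e.toFinset \ oddVertices A,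
      min ((G.degree u : ℝ) / G.degree v * (if e ∈ A then x⁻¹ else x)) 1 *
        (1 / (4 * (G.degree u : ℝ)))
  else 0

/-- The off-diagonal entries: `wormRate` if `B = A ∆ e` for a (unique) edge `e` of `G`,
and `0` otherwise. -/
def wormOffDiag (x : ℝ) (A B : WormState G) : ℝ :=
  ∑ e ∈ G.edgeFinset with symmDiff A.1 {e} = B.1, wormRate G x A.1 e

/-- The transition matrix `P_x` of the worm process (lazy Metropolis chain); the diagonal entries
make the rows sum to `1`. -/
def wormMatrix (x : ℝ) : Matrix (WormState G) (WormState G) ℝ := fun A B =>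
  if A = B then 1 - ∑ C ∈ univ.erase A, wormOffDiag G x A C else wormOffDiag G x A B

end Worm

end

/-! All bounds come from a Poincaré inequality for the worm process (`wormMatrix_poincare`), proved
with canonical paths and a weight-preserving encoding of the paths through a given transition.

For a function of mean zero, the second moment is at most the second moment about any value `g F`.
Averaging over the even states `F` leaves a sum over pairs `(I, F)` with `F` even. Write `I = F ∆
D`. Translation by an even set changes no odd vertices, so `D` is itself a worm state, and deleting
its edges in an order that keeps at most two odd vertices (`exists_removal_order`) gives a path from
`F ∆ D` to `F` inside the state space. Cauchy–Schwarz along the path costs at most `m`.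

Given `D`, a transition `A ↦ A ∆ e` of the path determines `F`, and with `B = insert e A` the
weights factor exactly, `x^|F ∆ D| x^|F| = x^|B| x^|D ∆ B|` (`card_symmDiff_add_card_insert`). The
factor `x^|B|` is at most `2Δ` times the equilibrium flow of the transition
(`le_psWeight_mul_wormRate`). The remaining sum over `D` is at most `n²` times the weight of the
even subgraphs (`sum_psFactor_mul_pow_symmDiff_le`), because Ising correlations are at most `1`
(`sum_pow_oddVertices_eq_le`). That even weight cancels against the averaging over `F`, leaving the
constant `4Δmn²`, which is at most `4Δmn⁴`.

Laziness makes `P` positive semidefinite, so the Poincaré inequality controls `lambdaStar` and the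
`ℓ²(π)` contraction without a spectral decomposition. The mixing times then follow from lower bounds
on `π` at the initial state. -/

/-! ### Reversible Markov chains satisfying a Poincaré inequality -/

section ReversibleChain

variable {Ω : Type*} [Fintype Ω]

/-- The inner product of `ℓ²(π)`. -/
def weightedInner (π f g : Ω → ℝ) : ℝ := ∑ ω, π ω * f ω * g ω

/-- The transition matrix `P` is reversible with respect to the positive probability vector `π`,
and it holds at each state with probability at least `1 / 2`. -/
structure IsLazyReversible (P : Matrix Ω Ω ℝ) (π : Ω → ℝ) : Prop where
  pos : ∀ ω, 0 < π ω
  sum_eq_one : ∑ ω, π ω = 1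
  row_sum : ∀ ω, ∑ ω', P ω ω' = 1
  nonneg : ∀ ω ω', 0 ≤ P ω ω'
  lazy : ∀ ω, 1 / 2 ≤ P ω ω
  reversible : ∀ ω ω', π ω * P ω ω' = π ω' * P ω' ω

/-- The Poincaré inequality with constant `R`. -/
def PoincareInequality (P : Matrix Ω Ω ℝ) (π : Ω → ℝ) (R : ℝ) : Prop :=
  ∀ f : Ω → ℝ, ∑ ω, π ω * f ω = 0 →
    weightedInner π f f ≤ R * ((1 / 2) * ∑ ω, ∑ ω', π ω * P ω ω' * (f ω - f ω') ^ 2)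

theorem weightedInner_self_nonneg {π : Ω → ℝ} (hπ : ∀ ω, 0 < π ω) (f : Ω → ℝ) :
    0 ≤ weightedInner π f f :=
  sum_nonneg fun ω _ => by rw [mul_assoc]; exact mul_nonneg (hπ ω).le (mul_self_nonneg _)

namespace IsLazyReversible

variable {P : Matrix Ω Ω ℝ} {π : Ω → ℝ}

theorem weightedInner_mulVec (h : IsLazyReversible P π) (f g : Ω → ℝ) :
    weightedInner π (P.mulVec f) g = weightedInner π f (P.mulVec g) := by
  simp only [weightedInner, Matrix.mulVec, dotProduct, mul_sum, sum_mul]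
  rw [sum_comm]
  refine sum_congr rfl fun ω _ => sum_congr rfl fun ω' _ => ?_
  linear_combination f ω * g ω' * h.reversible ω' ω

theorem sum_mul_mulVec (h : IsLazyReversible P π) (f : Ω → ℝ) :
    ∑ ω, π ω * P.mulVec f ω = ∑ ω, π ω * f ω := by
  have := h.weightedInner_mulVec f 1
  have h1 : P.mulVec 1 = 1 := by
    ext ω
    simp [Matrix.mulVec, dotProduct, h.row_sum ω]
  rw [h1] at this
  simpa [weightedInner] using this

theorem sum_sq_left (h : IsLazyReversible P π) (f : Ω → ℝ) :
    ∑ ω, ∑ ω', π ω * P ω ω' * f ω ^ 2 = weightedInner π f f := by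
  refine sum_congr rfl fun ω _ => ?_
  have : ∀ ω', π ω * P ω ω' * f ω ^ 2 = π ω * f ω ^ 2 * P ω ω' := fun _ => by ring
  simp_rw [this]
  rw [← mul_sum, h.row_sum]
  ring

theorem sum_sq_right (h : IsLazyReversible P π) (f : Ω → ℝ) :
    ∑ ω, ∑ ω', π ω * P ω ω' * f ω' ^ 2 = weightedInner π f f := by
  rw [sum_comm, ← h.sum_sq_left]
  refine sum_congr rfl fun ω _ => sum_congr rfl fun ω' _ => ?_
  rw [h.reversible]

theorem sum_cross (f : Ω → ℝ) :
    ∑ ω, ∑ ω', π ω * P ω ω' * (f ω * f ω') = weightedInner π f (P.mulVec f) := by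
  simp only [weightedInner, Matrix.mulVec, dotProduct, mul_sum]
  exact sum_congr rfl fun ω _ => sum_congr rfl fun ω' _ => by ring

theorem dirichlet_eq (h : IsLazyReversible P π) (f : Ω → ℝ) :
    (1 / 2) * ∑ ω, ∑ ω', π ω * P ω ω' * (f ω - f ω') ^ 2 =
      weightedInner π f f - weightedInner π f (P.mulVec f) := by
  have : ∀ ω ω', π ω * P ω ω' * (f ω - f ω') ^ 2 = π ω * P ω ω' * f ω ^ 2 +
      π ω * P ω ω' * f ω' ^ 2 - 2 * (π ω * P ω ω' * (f ω * f ω')) := fun _ _ => by ring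
  simp_rw [this, sum_sub_distrib, sum_add_distrib, ← mul_sum]
  rw [h.sum_sq_left, h.sum_sq_right, sum_cross]
  ring

/-- In the form with `(f ω + f ω')²`, the diagonal terms alone, with `P ω ω ≥ 1/2`, already
contribute `⟨f, f⟩`. -/
theorem weightedInner_mulVec_self_nonneg (h : IsLazyReversible P π) (f : Ω → ℝ) :
    0 ≤ weightedInner π f (P.mulVec f) := by
  have key : (1 / 2) * ∑ ω, ∑ ω', π ω * P ω ω' * (f ω + f ω') ^ 2 =
      weightedInner π f f + weightedInner π f (P.mulVec f) := by
    have : ∀ ω ω', π ω * P ω ω' * (f ω + f ω') ^ 2 = π ω * P ω ω' * f ω ^ 2 +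
        π ω * P ω ω' * f ω' ^ 2 + 2 * (π ω * P ω ω' * (f ω * f ω')) := fun _ _ => by ring
    simp_rw [this, sum_add_distrib, ← mul_sum]
    rw [h.sum_sq_left, h.sum_sq_right, sum_cross]
    ring
  have hdiag : 2 * weightedInner π f f ≤ ∑ ω, ∑ ω', π ω * P ω ω' * (f ω + f ω') ^ 2 := by
    rw [weightedInner, mul_sum]
    refine sum_le_sum fun ω _ => ?_
    refine le_trans ?_ (single_le_sum (f := fun ω' => π ω * P ω ω' * (f ω + f ω') ^ 2)
      (fun ω' _ => mul_nonneg (mul_nonneg (h.pos ω).le (h.nonneg ω ω')) (sq_nonneg _))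
      (mem_univ ω))
    have := mul_le_mul_of_nonneg_left (h.lazy ω)
      (mul_nonneg (h.pos ω).le (sq_nonneg (f ω)))
    calc 2 * (π ω * f ω * f ω) = 4 * (π ω * f ω ^ 2 * (1 / 2)) := by ring
      _ ≤ 4 * (π ω * f ω ^ 2 * P ω ω) := by linarith
      _ = π ω * P ω ω * (f ω + f ω) ^ 2 := by ring
  linarith

theorem weightedInner_mulVec_self_le (h : IsLazyReversible P π) {R : ℝ} (hR : 0 < R)
    (hP : PoincareInequality P π R) {f : Ω → ℝ} (hf : ∑ ω, π ω * f ω = 0) :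
    weightedInner π f (P.mulVec f) ≤ (1 - 1 / R) * weightedInner π f f := by
  have := hP f hf
  rw [h.dirichlet_eq] at this
  have h2 := (div_le_iff₀' hR).2 this
  have : (1 - 1 / R) * weightedInner π f f =
    weightedInner π f f - weightedInner π f f / R := by ring
  linarith

/-- This replaces diagonalization: with `c = 1 - 1/R`, positivity of `P` at `c f - P f` and the
Poincaré bound at `P f` give `c ⟨Pf, Pf⟩ ≤ c² ⟨f, Pf⟩`. Dividing by `c` is where `R > 1` is needed.
-/
theorem weightedInner_mulVec_mulVec_le (h : IsLazyReversible P π) {R : ℝ} (hR : 1 < R)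
    (hP : PoincareInequality P π R) {f : Ω → ℝ} (hf : ∑ ω, π ω * f ω = 0) :
    weightedInner π (P.mulVec f) (P.mulVec f) ≤ (1 - 1 / R) ^ 2 * weightedInner π f f := by
  have hR0 : 0 < R := by linarith
  set c := 1 - 1 / R with hc
  have hc0 : 0 < c := by
    have : 1 / R < 1 := (div_lt_one hR0).2 hR
    linarith
  have h1 := h.weightedInner_mulVec_self_le hR0 hP hf
  have h2 := h.weightedInner_mulVec_self_le hR0 hP
    (f := P.mulVec f) (by rw [h.sum_mul_mulVec, hf])
  have h3 := h.weightedInner_mulVec_self_nonneg (c • f - P.mulVec f)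
  have h4 : weightedInner π (c • f - P.mulVec f) (P.mulVec (c • f - P.mulVec f)) =
      c ^ 2 * weightedInner π f (P.mulVec f) - 2 * c * weightedInner π (P.mulVec f) (P.mulVec f)
        + weightedInner π (P.mulVec f) (P.mulVec (P.mulVec f)) := by
    have h5 := h.weightedInner_mulVec f (P.mulVec f)
    rw [Matrix.mulVec_sub, Matrix.mulVec_smul]
    have : weightedInner π (c • f - P.mulVec f) (c • P.mulVec f - P.mulVec (P.mulVec f)) =
      c ^ 2 * weightedInner π f (P.mulVec f) - c * weightedInner π f (P.mulVec (P.mulVec f))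
      - c * weightedInner π (P.mulVec f) (P.mulVec f)
        + weightedInner π (P.mulVec f) (P.mulVec (P.mulVec f)) := by
      simp only [weightedInner, mul_sum, ← sum_sub_distrib, ← sum_add_distrib]
      refine sum_congr rfl fun ω _ => ?_
      simp only [Pi.sub_apply, Pi.smul_apply, smul_eq_mul]
      ring
    rw [this]
    linear_combination c * h5
  rw [h4] at h3
  have h6 : c * weightedInner π (P.mulVec f) (P.mulVec f) ≤
      c * (c * weightedInner π f (P.mulVec f)) := by
    linarith
  have h7 := le_of_mul_le_mul_left h6 hc0
  have h8 := mul_le_mul_of_nonneg_left h1 hc0.le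
  calc _ ≤ _ := h7
    _ ≤ _ := h8
    _ = _ := by ring

theorem lambdaStar_le (h : IsLazyReversible P π) {R : ℝ} (hR : 1 ≤ R)
    (hP : PoincareInequality P π R) : lambdaStar P ≤ 1 - 1 / R := by
  have hR0 : 0 < R := by linarith
  refine Real.sSup_le ?_ ?_
  · rintro _ ⟨μ, ⟨f, hconst, hf⟩, rfl⟩
    set a := ∑ ω, π ω * f ω with ha
    set g : Ω → ℝ := fun ω => f ω - a with hg
    have hg0 : ∑ ω, π ω * g ω = 0 := by
      simp [hg, mul_sub, sum_sub_distrib, ← sum_mul, h.sum_eq_one, ← ha]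
    have hmean : (μ - 1) * a = 0 := by
      have := h.sum_mul_mulVec f
      rw [hf] at this
      have h2 : ∑ ω, π ω * (μ • f) ω = μ * a := by
        rw [ha, mul_sum]
        exact sum_congr rfl fun ω _ => by simp; ring
      rw [h2, ← ha] at this
      linarith
    have hPg : P.mulVec g = μ • g := by
      ext ω
      have h1 : P.mulVec g ω = P.mulVec f ω - a := by
        simp [Matrix.mulVec, dotProduct, hg, mul_sub, sum_sub_distrib, ← sum_mul, h.row_sum]
      rw [h1, hf]
      simp only [Pi.smul_apply, smul_eq_mul, hg]
      linear_combination hmean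
    have hgpos : 0 < weightedInner π g g := by
      refine lt_of_le_of_ne (weightedInner_self_nonneg h.pos g) fun h0 => hconst ⟨a, fun ω => ?_⟩
      have := (sum_eq_zero_iff_of_nonneg (fun ω _ => by
        rw [mul_assoc]; exact mul_nonneg (h.pos ω).le (mul_self_nonneg _))).1 h0.symm ω (mem_univ ω)
      have h2 : g ω = 0 := by
        rcases mul_eq_zero.1 this with h3 | h3
        · exact (mul_eq_zero.1 h3).resolve_left (h.pos ω).ne'
        · exact h3
      simpa [hg, sub_eq_zero] using h2
    have hin : weightedInner π g (P.mulVec g) = μ * weightedInner π g g := by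
      rw [hPg, weightedInner, weightedInner, mul_sum]
      exact sum_congr rfl fun ω _ => by simp; ring
    have h1 := h.weightedInner_mulVec_self_le hR0 hP hg0
    have h2 := h.weightedInner_mulVec_self_nonneg g
    rw [hin] at h1 h2
    have hμ : 0 ≤ μ := nonneg_of_mul_nonneg_left h2 hgpos
    simpa [abs_of_nonneg hμ] using le_of_mul_le_mul_right h1 hgpos
  -- The bound must be nonnegative because `sSup ∅ = 0` when there are no non-trivial eigenvalues.
  · have : 1 / R ≤ 1 := (div_le_one hR0).2 hR
    linarith

variable [DecidableEq Ω]

theorem reversible_pow (h : IsLazyReversible P π) (t : ℕ) (ω ω' : Ω) :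
    π ω * (P ^ t) ω ω' = π ω' * (P ^ t) ω' ω := by
  induction t generalizing ω ω' with
  | zero =>
    by_cases hω : ω = ω'
    · rw [hω]
    · simp [hω, Ne.symm hω]
  | succ t ih =>
    rw [pow_succ, Matrix.mul_apply, ← pow_succ, pow_succ', Matrix.mul_apply, mul_sum, mul_sum]
    refine sum_congr rfl fun ω'' _ => ?_
    linear_combination P ω'' ω' * ih ω ω'' + (P ^ t) ω'' ω * h.reversible ω'' ω'

theorem weightedInner_pow_mulVec_le (h : IsLazyReversible P π) {R : ℝ} (hR : 1 < R)
    (hP : PoincareInequality P π R) {f : Ω → ℝ} (hf : ∑ ω, π ω * f ω = 0) (t : ℕ) :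
    ∑ ω, π ω * (P ^ t).mulVec f ω = 0 ∧
    weightedInner π ((P ^ t).mulVec f) ((P ^ t).mulVec f) ≤
      ((1 - 1 / R) ^ t) ^ 2 * weightedInner π f f := by
  induction t with
  | zero => simp [hf]
  | succ t ih =>
    rw [pow_succ', ← Matrix.mulVec_mulVec]
    refine ⟨by rw [h.sum_mul_mulVec, ih.1], ?_⟩
    refine (h.weightedInner_mulVec_mulVec_le hR hP ih.1).trans ?_
    refine (mul_le_mul_of_nonneg_left ih.2 (sq_nonneg _)).trans (le_of_eq ?_)
    ring

theorem tvDist_pow_le (h : IsLazyReversible P π) {R : ℝ} (hR : 1 < R)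
    (hP : PoincareInequality P π R) (ω : Ω) (t : ℕ) :
    tvDist ((P ^ t) ω) π ≤ 1 / 2 * ((1 - 1 / R) ^ t * √(1 / π ω)) := by
  have hω := h.pos ω
  -- The centred density of the point mass at `ω` with respect to `π`. By reversibility `P ^ t`
  -- sends it to the centred density of `P ^ t ω`, so the `ℓ²` contraction bounds the `ℓ¹` distance
  -- through Cauchy–Schwarz.
  set f : Ω → ℝ := fun ω' => (if ω' = ω then 1 / π ω else 0) - 1 with hf
  have hrow : ∀ t ω', ∑ ω'', (P ^ t) ω' ω'' = 1 := by
    intro t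
    induction t with
    | zero => intro ω'; simp [Matrix.one_apply]
    | succ t ih =>
      intro ω'
      simp_rw [pow_succ, Matrix.mul_apply]
      rw [sum_comm]
      simp_rw [← mul_sum, h.row_sum, mul_one, ih]
  have hf0 : ∑ ω', π ω' * f ω' = 0 := by
    simp [hf, mul_sub, sum_sub_distrib, h.sum_eq_one, hω.ne']
  have hff : weightedInner π f f ≤ 1 / π ω := by
    have h1 : weightedInner π f f = ∑ ω', π ω' * (if ω' = ω then 1 / π ω * f ω' else 0) -
        ∑ ω', π ω' * f ω' := by
      rw [weightedInner, ← sum_sub_distrib]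
      refine sum_congr rfl fun ω' _ => ?_
      simp only [hf]
      split_ifs <;> ring
    rw [h1, hf0]
    simp only [mul_ite, mul_zero, sum_ite_eq', mem_univ, if_true, hf]
    have : π ω * (1 / π ω * (1 / π ω - 1)) = 1 / π ω - 1 := by field_simp
    linarith
  have hPf : ∀ ω', π ω' * |(P ^ t).mulVec f ω'| = |(P ^ t) ω ω' - π ω'| := by
    intro ω'
    have h1 : (P ^ t).mulVec f ω' = (P ^ t) ω' ω * (1 / π ω) - 1 := by
      simp [Matrix.mulVec, dotProduct, hf, mul_sub, sum_sub_distrib, hrow]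
    rw [h1, ← abs_of_pos (h.pos ω'), ← abs_mul, abs_of_pos (h.pos ω')]
    congr 1
    have h2 := h.reversible_pow t ω ω'
    field_simp
    linear_combination -h2
  have hmain := (h.weightedInner_pow_mulVec_le hR hP hf0 t).2
  have hc0 : 0 ≤ (1 - 1 / R) ^ t := by
    have : 1 / R ≤ 1 := (div_le_one (by linarith)).2 hR.le
    exact pow_nonneg (by linarith) _
  have hcs : (∑ ω', |(P ^ t) ω ω' - π ω'|) ^ 2 ≤
      weightedInner π ((P ^ t).mulVec f) ((P ^ t).mulVec f) := by
    have := sum_sq_le_sum_mul_sum_of_sq_le_mul univ (r := fun ω' => |(P ^ t) ω ω' - π ω'|)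
      (f := π) (g := fun ω' => π ω' * (P ^ t).mulVec f ω' * (P ^ t).mulVec f ω')
      (fun ω' _ => (h.pos ω').le)
      (fun ω' _ => by rw [mul_assoc]; exact mul_nonneg (h.pos ω').le (mul_self_nonneg _))
      (fun ω' _ => by
        rw [← hPf, mul_pow, sq_abs]
        exact le_of_eq (by ring))
    rwa [h.sum_eq_one, one_mul] at this
  have hfin : (∑ ω', |(P ^ t) ω ω' - π ω'|) ≤ (1 - 1 / R) ^ t * √(1 / π ω) := by
    refine abs_le_of_sq_le_sq' ?_ (mul_nonneg hc0 (Real.sqrt_nonneg _)) |>.2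
    rw [mul_pow, Real.sq_sqrt (by positivity)]
    exact hcs.trans (hmain.trans (mul_le_mul_of_nonneg_left hff (sq_nonneg _)))
  rw [tvDist]
  exact mul_le_mul_of_nonneg_left hfin (by norm_num)

/-- Exponential convergence to the stationary distribution, in terms of mixing times. -/
theorem mem_mixedTimes (h : IsLazyReversible P π) {R : ℝ} (hR : 1 < R)
    (hP : PoincareInequality P π R) (ω : Ω) {δ : ℝ} (hδ : 0 < δ) {t : ℕ}
    (ht : R * (Real.log δ⁻¹ + 1 / 2 * Real.log (1 / π ω)) ≤ t) : t ∈ mixedTimes P π ω δ := by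
  have hR0 : 0 < R := by linarith
  have hω := h.pos ω
  refine (h.tvDist_pow_le hR hP ω t).trans ?_
  have h1 : (1 - 1 / R) ^ t ≤ Real.exp (-(1 / R) * t) := by
    rw [mul_comm, Real.exp_nat_mul]
    refine pow_le_pow_left₀ ?_ ?_ t
    · have : 1 / R ≤ 1 := (div_le_one hR0).2 hR.le
      linarith
    · have := Real.add_one_le_exp (-(1 / R))
      linarith
  have h2 : √(1 / π ω) = Real.exp (1 / 2 * Real.log (1 / π ω)) := by
    rw [Real.sqrt_eq_rpow, Real.rpow_def_of_pos (by positivity), mul_comm]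
  have h3 : (1 - 1 / R) ^ t * √(1 / π ω) ≤ δ := by
    rw [h2]
    refine (mul_le_mul_of_nonneg_right h1 (Real.exp_pos _).le).trans ?_
    rw [← Real.exp_add, ← Real.le_log_iff_exp_le hδ]
    rw [Real.log_inv, ← le_div_iff₀' hR0] at ht
    have : -(1 / R) * t = -(t / R) := by ring
    linarith
  have h4 : 0 ≤ (1 - 1 / R) ^ t * √(1 / π ω) := by
    have : 1 / R ≤ 1 := (div_le_one hR0).2 hR.le
    exact mul_nonneg (pow_nonneg (by linarith) _) (Real.sqrt_nonneg _)
  linarith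

theorem mixingTimeFrom_le (h : IsLazyReversible P π) {R : ℝ} (hR : 1 < R)
    (hP : PoincareInequality P π R) (ω : Ω) {δ T : ℝ} (hδ : 0 < δ) (hT0 : 0 ≤ T)
    (hT : R * (Real.log δ⁻¹ + 1 / 2 * Real.log (1 / π ω)) + 1 ≤ T) :
    (mixingTimeFrom P π ω δ : ℝ) ≤ T := by
  -- The `+ 1` in `hT` pays for rounding `T` down to an integer time.
  have h1 : ⌊T⌋₊ ∈ mixedTimes P π ω δ :=
    h.mem_mixedTimes hR hP ω hδ (by linarith [Nat.lt_floor_add_one T])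
  exact (Nat.cast_le.2 (Nat.sInf_le h1)).trans (Nat.floor_le hT0)

end IsLazyReversible

end ReversibleChain

/-! ### Odd vertices of sets of edges -/

section OddVertices

theorem card_symmDiff_add_two_mul_card_inter {α : Type*} [DecidableEq α] (X Y : Finset α) :
    #(symmDiff X Y) + 2 * #(X ∩ Y) = #X + #Y := by
  have h1 : #(symmDiff X Y) = #(X \ Y) + #(Y \ X) := by
    rw [symmDiff_def, sup_eq_union, card_union_of_disjoint disjoint_sdiff_sdiff]
  have h2 := card_sdiff_add_card_inter X Y
  have h3 := card_sdiff_add_card_inter Y X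
  rw [inter_comm] at h3
  omega

theorem odd_card_symmDiff {α : Type*} [DecidableEq α] (X Y : Finset α) :
    Odd #(symmDiff X Y) ↔ ¬ (Odd #X ↔ Odd #Y) := by
  have h := card_symmDiff_add_two_mul_card_inter X Y
  simp only [Nat.odd_iff]
  omega

theorem symmDiff_singleton_of_notMem {α : Type*} [DecidableEq α] (S : Finset α) (e : α)
    (he : e ∉ S) :
    symmDiff S {e} = insert e S := by
  ext a
  simp only [mem_symmDiff, mem_singleton, mem_insert]
  grind

variable {V : Type*} [Fintype V] [DecidableEq V]

theorem oddVertices_symmDiff (A B : Finset (Sym2 V)) :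
    oddVertices (symmDiff A B) = symmDiff (oddVertices A) (oddVertices B) := by
  ext v
  have : ({u : V | s(u, v) ∈ symmDiff A B} : Finset V) =
      symmDiff ({u : V | s(u, v) ∈ A} : Finset V) ({u : V | s(u, v) ∈ B} : Finset V) := by
    ext u; simp [mem_symmDiff]
  rw [mem_symmDiff, oddVertices, mem_filter, this, odd_card_symmDiff]
  simp only [oddVertices, mem_filter, mem_univ, true_and]
  tauto

@[simp]
theorem oddVertices_empty : oddVertices (∅ : Finset (Sym2 V)) = ∅ := by
  simp [oddVertices]

theorem oddVertices_singleton {e : Sym2 V} (he : ¬ e.IsDiag) : oddVertices {e} = e.toFinset := by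
  induction e with | _ a b
  simp only [Sym2.mk_isDiag_iff] at he
  ext v
  simp only [oddVertices, mem_filter, mem_univ, true_and, mem_singleton, Sym2.mem_toFinset,
    Sym2.mem_iff, Sym2.eq_iff]
  by_cases ha : v = a
  · subst ha
    have : ({u : V | u = v ∧ v = b ∨ u = b ∧ v = v} : Finset V) = {b} := by
      ext u
      simp only [mem_filter, mem_univ, true_and, mem_singleton]
      grind
    rw [this]
    simp
  by_cases hb : v = b
  · subst hb
    have : ({u : V | u = a ∧ v = v ∨ u = v ∧ v = a} : Finset V) = {a} := by
      ext u
      simp only [mem_filter, mem_univ, true_and, mem_singleton]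
      grind
    rw [this]
    simp
  · simp [ha, hb]

/-- Having no or two odd vertices. -/
def FewOdd (A : Finset (Sym2 V)) : Prop := #(oddVertices A) = 0 ∨ #(oddVertices A) = 2

/-- With no odd vertex, any edge will do. With two, an odd vertex `u` has positive degree; deleting
an edge `wu` moves the odd vertex from `u` to `w`, or removes both odd vertices if `w` is the other
one. -/
theorem exists_fewOdd_erase {D : Finset (Sym2 V)} (hloop : ∀ e ∈ D, ¬ e.IsDiag)
    (hD : FewOdd D) (hne : D.Nonempty) : ∃ e ∈ D, FewOdd (D.erase e) := by
  have herase : ∀ e ∈ D, oddVertices (D.erase e) = symmDiff (oddVertices D) e.toFinset := by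
    intro e he
    rw [← oddVertices_singleton (hloop e he), ← oddVertices_symmDiff]
    congr 1
    ext a
    simp only [mem_symmDiff, mem_singleton, mem_erase]
    grind
  rcases hD with h0 | h2
  · obtain ⟨e, he⟩ := hne
    refine ⟨e, he, Or.inr ?_⟩
    rw [herase e he, card_eq_zero.1 h0, ← bot_eq_empty, bot_symmDiff]
    exact Sym2.card_toFinset_of_not_isDiag e (hloop e he)
  · obtain ⟨u, v, huv, hodd⟩ := card_eq_two.1 h2
    have hu : u ∈ oddVertices D := by simp [hodd]
    simp only [oddVertices, mem_filter, mem_univ, true_and] at hu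
    obtain ⟨w, hw⟩ := card_pos.1 hu.pos
    simp only [mem_filter, mem_univ, true_and] at hw
    have hwu : w ≠ u := by simpa using hloop _ hw
    refine ⟨s(w, u), hw, ?_⟩
    rw [FewOdd, herase _ hw, hodd]
    by_cases hwv : w = v
    · subst hwv
      left
      rw [card_eq_zero]
      ext a; simp [mem_symmDiff]; grind
    · right
      rw [card_eq_two]
      refine ⟨v, w, Ne.symm hwv, ?_⟩
      ext a; simp [mem_symmDiff]; grind

/-- The edges of `D` can be removed one after the other while keeping at most two odd vertices:
`suf e` consists of the edges present when `e` is about to be removed. -/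
theorem exists_removal_order {D : Finset (Sym2 V)} (hloop : ∀ e ∈ D, ¬ e.IsDiag)
    (hD : FewOdd D) : ∃ suf : Sym2 V → Finset (Sym2 V),
      (∀ e ∈ D, e ∈ suf e ∧ suf e ⊆ D ∧ FewOdd (suf e) ∧ FewOdd ((suf e).erase e)) ∧
      ∀ (g : Finset (Sym2 V) → ℝ) (F : Finset (Sym2 V)),
        g (symmDiff F D) - g F =
          ∑ e ∈ D, (g (symmDiff F (suf e)) - g (symmDiff F ((suf e).erase e))) := by
  induction D using Finset.strongInduction with
  | _ D ih =>
    rcases D.eq_empty_or_nonempty with rfl | hne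
    · exact ⟨fun _ => ∅, by simp, fun g F => by
        rw [sum_empty, ← bot_eq_empty, symmDiff_bot, sub_self]⟩
    · obtain ⟨e₀, he₀, hfew⟩ := exists_fewOdd_erase hloop hD hne
      obtain ⟨suf, hsuf, htel⟩ := ih (D.erase e₀) (erase_ssubset he₀)
        (fun e he => hloop e (mem_of_mem_erase he)) hfew
      -- The edge `e₀` is removed first, when all of `D` is still present. Indexing the path by
      -- edges lets a transition name its own position on the path.
      refine ⟨Function.update suf e₀ D, ?_, ?_⟩
      · intro e he
        by_cases h : e = e₀
        · subst h
          simpa using ⟨he, hD, hfew⟩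
        · obtain ⟨h1, h2, h3, h4⟩ := hsuf e (mem_erase.2 ⟨h, he⟩)
          rw [Function.update_of_ne h]
          exact ⟨h1, h2.trans (erase_subset _ _), h3, h4⟩
      · intro g F
        rw [← add_sum_erase _ _ he₀, Function.update_self]
        have : ∑ e ∈ D.erase e₀, (g (symmDiff F (Function.update suf e₀ D e)) -
            g (symmDiff F ((Function.update suf e₀ D e).erase e))) =
            ∑ e ∈ D.erase e₀, (g (symmDiff F (suf e)) - g (symmDiff F ((suf e).erase e))) :=
          sum_congr rfl fun e he => by rw [Function.update_of_ne (ne_of_mem_erase he)]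
        rw [this, ← htel]
        ring

end OddVertices

/-! ### The high-temperature expansion -/

section HighTemperature

section Character

variable {V : Type*} [DecidableEq V]

/-- The characters of the group of sets of vertices: `(-1)^|S ∩ T|`. -/
def signChar (S T : Finset V) : ℝ := ∏ v ∈ S, if v ∈ T then -1 else 1

theorem signChar_symmDiff (S T T' : Finset V) :
    signChar S (symmDiff T T') = signChar S T * signChar S T' := by
  rw [signChar, signChar, signChar, ← prod_mul_distrib]
  refine prod_congr rfl fun v _ => ?_
  by_cases h : v ∈ T <;> by_cases h' : v ∈ T' <;> simp [mem_symmDiff, h, h']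

theorem abs_signChar (S T : Finset V) : |signChar S T| = 1 := by
  rw [signChar, abs_prod]
  refine prod_eq_one fun v _ => ?_
  split_ifs <;> simp

end Character

variable {V : Type*} [Fintype V] [DecidableEq V]

theorem sum_signChar (T : Finset V) :
    ∑ S, signChar S T = if T = ∅ then 2 ^ Fintype.card V else 0 := by
  have h := prod_one_add (univ : Finset V) (f := fun v => if v ∈ T then (-1 : ℝ) else 1)
  rw [powerset_univ] at h
  simp only [signChar]
  rw [← h]
  split_ifs with hT
  · subst hT
    simp only [notMem_empty, if_false, prod_const, card_univ]
    norm_num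
  · obtain ⟨v, hv⟩ := nonempty_iff_ne_empty.2 hT
    exact prod_eq_zero (mem_univ v) (by simp [hv])

theorem signChar_oddVertices (S : Finset V) (A : Finset (Sym2 V)) :
    signChar S (oddVertices A) = ∏ e ∈ A, signChar S (oddVertices {e}) := by
  induction A using Finset.induction_on with
  | empty => simp [signChar]
  | insert e A he ih =>
    rw [prod_insert he, ← symmDiff_singleton_of_notMem A e he, oddVertices_symmDiff,
      signChar_symmDiff, ih, mul_comm]

/-- The Ising correlations are at most `1`: prescribing the set of odd vertices to be `T` gives
at most the weight of the even subgraphs. -/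
theorem sum_pow_oddVertices_eq_le (E : Finset (Sym2 V)) {x : ℝ} (hx0 : 0 ≤ x) (hx1 : x ≤ 1)
    (T : Finset V) :
    ∑ A ∈ E.powerset with oddVertices A = T, x ^ #A ≤
      ∑ A ∈ E.powerset with oddVertices A = ∅, x ^ #A := by
  -- The Fourier transform, over sets of vertices, of the weight as a function of the set of odd
  -- vertices. It is the partition function with spins `-1` on `S`, a product over edges of `1 ± x`
  -- or `1 + x`, hence nonnegative.
  set Z : Finset V → ℝ := fun S => ∑ A ∈ E.powerset, x ^ #A * signChar S (oddVertices A) with hZ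
  have hZ0 : ∀ S, 0 ≤ Z S := by
    intro S
    have : Z S = ∏ e ∈ E, (1 + x * signChar S (oddVertices {e})) := by
      rw [prod_one_add]
      refine sum_congr rfl fun A _ => ?_
      rw [prod_mul_distrib, prod_const, signChar_oddVertices]
    rw [this]
    refine prod_nonneg fun e _ => ?_
    have h1 := (abs_le.1 (abs_signChar S (oddVertices {e})).le).1
    nlinarith
  -- Fourier inversion; since `Z ≥ 0`, the inverse transform is largest at `T = ∅`.
  have hsum : ∀ T, ∑ S, signChar S T * Z S =
      2 ^ Fintype.card V * ∑ A ∈ E.powerset with oddVertices A = T, x ^ #A := by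
    intro T
    simp only [hZ, mul_sum]
    rw [sum_comm, sum_filter]
    refine sum_congr rfl fun A _ => ?_
    have h1 : ∀ S, signChar S T * (x ^ #A * signChar S (oddVertices A)) =
        x ^ #A * signChar S (symmDiff (oddVertices A) T) := by
      intro S; rw [signChar_symmDiff]; ring
    simp_rw [h1]
    rw [← mul_sum, sum_signChar]
    simp only [← bot_eq_empty, symmDiff_eq_bot, mul_comm (x ^ #A), ite_mul, zero_mul]
  have hle : ∑ S, signChar S T * Z S ≤ ∑ S, signChar S ∅ * Z S := by
    refine sum_le_sum fun S _ => mul_le_mul_of_nonneg_right ?_ (hZ0 S)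
    have h1 : signChar S ∅ = 1 := by simp [signChar]
    rw [h1]
    exact (abs_le.1 (abs_signChar S T).le).2
  rw [hsum, hsum] at hle
  exact le_of_mul_le_mul_left hle (by positivity)

variable (G : SimpleGraph V) [DecidableRel G.Adj]

theorem mem_oddClass {k : ℕ} {A : Finset (Sym2 V)} :
    A ∈ oddClass G k ↔ A ⊆ G.edgeFinset ∧ #(oddVertices A) = k := by
  simp [oddClass]

theorem mem_wormState {A : Finset (Sym2 V)} :
    A ∈ oddClass G 0 ∪ oddClass G 2 ↔ A ⊆ G.edgeFinset ∧ FewOdd A := by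
  simp only [mem_union, mem_oddClass, FewOdd]
  tauto

theorem edgeWeight_zero_eq (x : ℝ) : edgeWeight x (oddClass G 0) =
    ∑ A ∈ G.edgeFinset.powerset with oddVertices A = ∅, x ^ #A := by
  simp only [edgeWeight, oddClass, card_eq_zero]

/-- The translation `D ↦ D ∆ B` only changes the prescribed odd set, from `T` to `T ∆ ∂B`, so the
correlation bound applies. -/
theorem sum_pow_symmDiff_le {x : ℝ} (hx0 : 0 ≤ x) (hx1 : x ≤ 1) {B : Finset (Sym2 V)}
    (hB : B ⊆ G.edgeFinset) (T : Finset V) :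
    ∑ D ∈ G.edgeFinset.powerset with oddVertices D = T, x ^ #(symmDiff D B) ≤
      edgeWeight x (oddClass G 0) := by
  rw [edgeWeight_zero_eq]
  refine le_trans (le_of_eq ?_)
    (sum_pow_oddVertices_eq_le G.edgeFinset hx0 hx1 (symmDiff T (oddVertices B)))
  have hsub : ∀ {D : Finset (Sym2 V)}, D ⊆ G.edgeFinset → symmDiff D B ⊆ G.edgeFinset := by
    intro D hD
    exact symmDiff_le_sup.trans (sup_le hD hB)
  refine sum_nbij' (fun D => symmDiff D B) (fun D => symmDiff D B) ?_ ?_ ?_ ?_ ?_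
  · intro D hD
    simp only [mem_filter, mem_powerset] at hD ⊢
    exact ⟨hsub hD.1, by rw [oddVertices_symmDiff, hD.2]⟩
  · intro D hD
    simp only [mem_filter, mem_powerset] at hD ⊢
    exact ⟨hsub hD.1, by rw [oddVertices_symmDiff, hD.2, symmDiff_symmDiff_cancel_right]⟩
  · intro D _; exact symmDiff_symmDiff_cancel_right B D
  · intro D _; exact symmDiff_symmDiff_cancel_right B D
  · intro D _; rfl

/-- The factor `ψ` in the Prokof'ev-Svistunov measure. -/
def psFactor (A : Finset (Sym2 V)) : ℝ := if A ∈ oddClass G 0 then (Fintype.card V : ℝ) else 2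

theorem disjoint_oddClass : Disjoint (oddClass G 0) (oddClass G 2) := by
  rw [disjoint_left]
  intro A h0 h2
  have h0 := ((mem_oddClass G).1 h0).2
  have h2 := ((mem_oddClass G).1 h2).2
  omega

theorem sum_psFactor_mul (h : Finset (Sym2 V) → ℝ) :
    ∑ A ∈ oddClass G 0 ∪ oddClass G 2, psFactor G A * h A =
      Fintype.card V * ∑ A ∈ oddClass G 0, h A + 2 * ∑ A ∈ oddClass G 2, h A := by
  rw [sum_union (disjoint_oddClass G), mul_sum, mul_sum]
  refine congrArg₂ (· + ·) (sum_congr rfl fun A hA => ?_) (sum_congr rfl fun A hA => ?_)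
  · rw [psFactor, if_pos hA]
  · rw [psFactor, if_neg (disjoint_right.1 (disjoint_oddClass G) hA)]

/-- There is one odd set of size `0` and there are `n.choose 2` of size `2`, each contributing at
most the even weight: `n + 2 · n(n-1)/2 = n²`. -/
theorem sum_psFactor_mul_pow_symmDiff_le {x : ℝ} (hx0 : 0 ≤ x) (hx1 : x ≤ 1)
    {B : Finset (Sym2 V)} (hB : B ⊆ G.edgeFinset) :
    ∑ D ∈ oddClass G 0 ∪ oddClass G 2, psFactor G D * x ^ #(symmDiff D B) ≤
      (Fintype.card V : ℝ) ^ 2 * edgeWeight x (oddClass G 0) := by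
  refine (sum_psFactor_mul G fun D => x ^ #(symmDiff D B)).trans_le ?_
  have h0 := sum_pow_symmDiff_le G hx0 hx1 hB ∅
  have h2 : ∑ D ∈ oddClass G 2, x ^ #(symmDiff D B) ≤
      (Fintype.card V).choose 2 * edgeWeight x (oddClass G 0) := by
    have hmaps : ∀ D ∈ oddClass G 2, oddVertices D ∈ powersetCard 2 (univ : Finset V) := by
      intro D hD
      simpa [mem_powersetCard] using ((mem_oddClass G).1 hD).2
    rw [← sum_fiberwise_of_maps_to hmaps, ← card_univ, ← card_powersetCard, ← nsmul_eq_mul]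
    refine sum_le_card_nsmul _ _ _ fun T hT => ?_
    refine le_trans (sum_le_sum_of_subset_of_nonneg ?_ ?_) (sum_pow_symmDiff_le G hx0 hx1 hB T)
    · intro D hD
      simp only [oddClass, mem_filter] at hD ⊢
      exact ⟨hD.1.1, hD.2⟩
    · intros; positivity
  have h0' : ∑ D ∈ oddClass G 0, x ^ #(symmDiff D B) ≤ edgeWeight x (oddClass G 0) := by
    simpa only [oddClass, card_eq_zero] using h0
  rw [Nat.cast_choose_two] at h2
  have := mul_le_mul_of_nonneg_left h0' (Nat.cast_nonneg (α := ℝ) (Fintype.card V))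
  linarith

end HighTemperature

/-! ### The worm process as a lazy reversible chain -/

section WormChain

variable {V : Type*} [Fintype V] [DecidableEq V] (G : SimpleGraph V) [DecidableRel G.Adj]

theorem oddVertices_symmDiff_singleton {e : Sym2 V} (he : e ∈ G.edgeFinset)
    (A : Finset (Sym2 V)) :
    oddVertices (symmDiff A {e}) = symmDiff (oddVertices A) e.toFinset := by
  rw [oddVertices_symmDiff, oddVertices_singleton (G.not_isDiag_of_mem_edgeFinset he)]

theorem insert_symmDiff_singleton {α : Type*} [DecidableEq α] (A : Finset α) (e : α) :
    insert e (symmDiff A {e}) = insert e A := by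
  ext a
  simp only [mem_insert, mem_symmDiff, mem_singleton]
  grind

theorem symmDiff_singleton_subset_insert {α : Type*} [DecidableEq α] (A : Finset α) (e : α) :
    symmDiff A {e} ⊆ insert e A :=
  (subset_insert e _).trans (insert_symmDiff_singleton A e).subset

theorem pow_card_insert {α : Type*} [DecidableEq α] (x : ℝ) (A : Finset α) (e : α) :
    x ^ #A * (if e ∈ A then 1 else x) = x ^ #(insert e A) := by
  split_ifs with h
  · rw [insert_eq_of_mem h, mul_one]
  · rw [card_insert_of_notMem h, pow_succ]

theorem pow_card_symmDiff_singleton {α : Type*} [DecidableEq α] {x : ℝ} (hx : x ≠ 0)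
    (A : Finset α) (e : α) :
    x ^ #A * (if e ∈ A then x⁻¹ else x) = x ^ #(symmDiff A {e}) := by
  split_ifs with h
  · have h1 : symmDiff A {e} = A.erase e := by
      ext a
      simp only [mem_symmDiff, mem_singleton, mem_erase]
      grind
    rw [h1, ← card_erase_add_one h, pow_succ, mul_assoc, mul_inv_cancel₀ hx, mul_one]
  · rw [symmDiff_singleton_of_notMem A e h, card_insert_of_notMem h, pow_succ]

/-- The weight of a state, the Prokof'ev-Svistunov measure without its normalization. -/
def psWeight (x : ℝ) (A : Finset (Sym2 V)) : ℝ := x ^ #A * psFactor G A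

/-- The normalization of the Prokof'ev-Svistunov measure. -/
def psTotal (x : ℝ) : ℝ :=
  Fintype.card V * edgeWeight x (oddClass G 0) + 2 * edgeWeight x (oddClass G 2)

theorem psMeasure_eq (x : ℝ) (A : WormState G) :
    psMeasure G x A = psWeight G x A.1 / psTotal G x := rfl

theorem sum_wormState (f : Finset (Sym2 V) → ℝ) :
    ∑ A : WormState G, f A.1 = ∑ A ∈ oddClass G 0 ∪ oddClass G 2, f A :=
  (sum_subtype (oddClass G 0 ∪ oddClass G 2) (fun _ => Iff.rfl) f).symm

theorem sum_psWeight (x : ℝ) :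
    ∑ A ∈ oddClass G 0 ∪ oddClass G 2, psWeight G x A = psTotal G x := by
  rw [psTotal, edgeWeight, edgeWeight, ← sum_psFactor_mul G fun A => x ^ #A]
  exact sum_congr rfl fun A _ => mul_comm _ _

variable {G} {x : ℝ}

theorem one_le_edgeWeight_zero (hx0 : 0 < x) : 1 ≤ edgeWeight x (oddClass G 0) := by
  have h : (∅ : Finset (Sym2 V)) ∈ oddClass G 0 := by simp [mem_oddClass]
  have h1 := single_le_sum (f := fun A : Finset (Sym2 V) => x ^ #A) (fun A _ => by positivity) h
  simpa [edgeWeight] using h1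

theorem psFactor_pos [Nonempty V] (A : Finset (Sym2 V)) : 0 < psFactor G A := by
  have := Fintype.card_pos (α := V)
  rw [psFactor]
  split_ifs <;> positivity

theorem psWeight_pos [Nonempty V] (hx0 : 0 < x) (A : Finset (Sym2 V)) : 0 < psWeight G x A :=
  mul_pos (by positivity) (psFactor_pos A)

theorem psTotal_pos [Nonempty V] (hx0 : 0 < x) : 0 < psTotal G x := by
  have h1 : 0 < (Fintype.card V : ℝ) := Nat.cast_pos.2 Fintype.card_pos
  have h2 := one_le_edgeWeight_zero (G := G) hx0
  have h3 : 0 ≤ edgeWeight x (oddClass G 2) := sum_nonneg fun _ _ => by positivity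
  have : 0 < (Fintype.card V : ℝ) * edgeWeight x (oddClass G 0) := by positivity
  rw [psTotal]
  linarith

theorem psMeasure_pos [Nonempty V] (hx0 : 0 < x) (A : WormState G) : 0 < psMeasure G x A :=
  div_pos (psWeight_pos hx0 _) (psTotal_pos hx0)

theorem sum_psMeasure [Nonempty V] (hx0 : 0 < x) : ∑ A, psMeasure G x A = 1 := by
  simp_rw [psMeasure_eq, ← sum_div]
  rw [sum_wormState, sum_psWeight, div_self (psTotal_pos hx0).ne']

/-- The equilibrium flow out of an even state, up to normalization. -/
theorem psWeight_mul_wormRate_of_left [Nonempty V] {A : Finset (Sym2 V)} {e : Sym2 V}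
    (hA : A ∈ oddClass G 0) : psWeight G x A * wormRate G x A e =
      x ^ #(insert e A) * (1 / 2) * ∑ w ∈ e.toFinset, 1 / (G.degree w : ℝ) := by
  have h1 : (Fintype.card V : ℝ) ≠ 0 := Nat.cast_ne_zero.2 Fintype.card_ne_zero
  rw [psWeight, psFactor, if_pos hA, wormRate, if_pos hA, ← pow_card_insert]
  field_simp

theorem psWeight_mul_wormRate_of_right {A : Finset (Sym2 V)} {e : Sym2 V}
    (hA : A ∉ oddClass G 0) (hA' : symmDiff A {e} ∈ oddClass G 0) :
    psWeight G x A * wormRate G x A e =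
      x ^ #(insert e A) * (1 / 2) * ∑ w ∈ e.toFinset, 1 / (G.degree w : ℝ) := by
  rw [psWeight, psFactor, if_neg hA, wormRate, if_neg hA, if_pos hA', ← pow_card_insert]
  ring

theorem psWeight_mul_wormRate_of_two (hx0 : 0 < x) (hdeg : ∀ v, 0 < G.degree v)
    {A : Finset (Sym2 V)} {e : Sym2 V}
    (hA : A ∈ oddClass G 2) (hA' : symmDiff A {e} ∈ oddClass G 2) :
    psWeight G x A * wormRate G x A e =
      ∑ u ∈ e.toFinset ∩ oddVertices A, ∑ v ∈ e.toFinset \ oddVertices A,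
        min (x ^ #(symmDiff A {e}) / G.degree v) (x ^ #A / G.degree u) / 2 := by
  have hd := disjoint_right.1 (disjoint_oddClass G)
  rw [psWeight, psFactor, if_neg (hd hA), wormRate, if_neg (hd hA), if_neg (hd hA'),
    if_pos ⟨hA, hA'⟩, mul_sum]
  refine sum_congr rfl fun u _ => ?_
  rw [mul_sum]
  refine sum_congr rfl fun v _ => ?_
  have hu : (0 : ℝ) < G.degree u := Nat.cast_pos.2 (hdeg u)
  have hv : (0 : ℝ) < G.degree v := Nat.cast_pos.2 (hdeg v)
  have hc : 0 ≤ x ^ #A / (G.degree u : ℝ) := by positivity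
  rw [← pow_card_symmDiff_singleton hx0.ne']
  generalize (if e ∈ A then x⁻¹ else x) = y
  have h1 : x ^ #A * y / G.degree v =
      x ^ #A / G.degree u * ((G.degree u : ℝ) / G.degree v * y) := by
    field_simp
  have h2 : x ^ #A / (G.degree u : ℝ) = x ^ #A / G.degree u * 1 := by ring
  rw [h1]
  nth_rw 2 [h2]
  rw [← mul_min_of_nonneg _ _ hc]
  field_simp
  ring

theorem card_inter_and_sdiff_of_two {A : Finset (Sym2 V)} {e : Sym2 V} (he : e ∈ G.edgeFinset)
    (hA : A ∈ oddClass G 2) (hA' : symmDiff A {e} ∈ oddClass G 2) :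
    #(e.toFinset ∩ oddVertices A) = 1 ∧ #(e.toFinset \ oddVertices A) = 1 := by
  have h1 := ((mem_oddClass G).1 hA).2
  have h2 := ((mem_oddClass G).1 hA').2
  have h3 := Sym2.card_toFinset_of_not_isDiag e (G.not_isDiag_of_mem_edgeFinset he)
  rw [oddVertices_symmDiff_singleton G he, symmDiff_def, sup_eq_union,
    card_union_of_disjoint disjoint_sdiff_sdiff] at h2
  have h4 := card_sdiff_add_card_inter (oddVertices A) e.toFinset
  have h5 := card_sdiff_add_card_inter e.toFinset (oddVertices A)
  rw [inter_comm] at h4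
  omega

theorem inter_sdiff_oddVertices_symmDiff {A : Finset (Sym2 V)} {e : Sym2 V}
    (he : e ∈ G.edgeFinset) :
    e.toFinset ∩ oddVertices (symmDiff A {e}) = e.toFinset \ oddVertices A ∧
      e.toFinset \ oddVertices (symmDiff A {e}) = e.toFinset ∩ oddVertices A := by
  rw [oddVertices_symmDiff_singleton G he]
  constructor <;>
  · ext v
    simp only [mem_inter, mem_sdiff, mem_symmDiff]
    tauto

theorem notMem_oddClass_zero_of_symmDiff {A : Finset (Sym2 V)} {e : Sym2 V}
    (he : e ∈ G.edgeFinset) (hA : A ∈ oddClass G 0) : symmDiff A {e} ∉ oddClass G 0 := by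
  intro h
  have h1 := card_eq_zero.1 ((mem_oddClass G).1 hA).2
  have h2 := ((mem_oddClass G).1 h).2
  have h3 := Sym2.card_toFinset_of_not_isDiag e (G.not_isDiag_of_mem_edgeFinset he)
  rw [oddVertices_symmDiff_singleton G he, h1, ← bot_eq_empty, bot_symmDiff] at h2
  omega

/-- The factors `n` and `2` of `ψ` cancel the `1/(2n)` and `1/4` of the rates, leaving flows that
depend on `insert e A` alone. Between two states with two odd vertices, the flip exchanges the odd
and the even endpoint of `e`, hence the arguments of the minimum. -/
theorem psWeight_mul_wormRate_symm [Nonempty V] (hx0 : 0 < x) (hdeg : ∀ v, 0 < G.degree v)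
    {A : Finset (Sym2 V)} {e : Sym2 V} (he : e ∈ G.edgeFinset)
    (hA : A ∈ oddClass G 0 ∪ oddClass G 2) (hA' : symmDiff A {e} ∈ oddClass G 0 ∪ oddClass G 2) :
    psWeight G x A * wormRate G x A e =
      psWeight G x (symmDiff A {e}) * wormRate G x (symmDiff A {e}) e := by
  by_cases h0 : A ∈ oddClass G 0
  · rw [psWeight_mul_wormRate_of_left h0, psWeight_mul_wormRate_of_right
      (notMem_oddClass_zero_of_symmDiff he h0) (by rwa [symmDiff_symmDiff_cancel_right]),
      insert_symmDiff_singleton]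
  have h2 := (mem_union.1 hA).resolve_left h0
  by_cases h0' : symmDiff A {e} ∈ oddClass G 0
  · rw [psWeight_mul_wormRate_of_left h0', psWeight_mul_wormRate_of_right h0 h0',
      insert_symmDiff_singleton]
  have h2' := (mem_union.1 hA').resolve_left h0'
  obtain ⟨h3, h4⟩ := inter_sdiff_oddVertices_symmDiff (A := A) he
  rw [psWeight_mul_wormRate_of_two hx0 hdeg h2 h2', psWeight_mul_wormRate_of_two hx0 hdeg h2'
    (by rwa [symmDiff_symmDiff_cancel_right]), h3, h4, sum_comm]
  simp_rw [symmDiff_symmDiff_cancel_right]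
  exact sum_congr rfl fun u _ => sum_congr rfl fun v _ => by rw [min_comm]

theorem wormRate_nonneg (hx0 : 0 < x) (A : Finset (Sym2 V)) (e : Sym2 V) :
    0 ≤ wormRate G x A e := by
  have h1 : 0 ≤ (if e ∈ A then 1 else x) := by split_ifs <;> positivity
  have h2 : 0 ≤ (if e ∈ A then x⁻¹ else x) := by split_ifs <;> positivity
  have h3 : 0 ≤ ∑ w ∈ e.toFinset, 1 / (G.degree w : ℝ) := sum_nonneg fun _ _ => by positivity
  rw [wormRate]
  split_ifs
  all_goals positivity

/-- Both `A` and `A ∆ e` lie in `insert e A`, so with `x ≤ 1` the larger set gives a lower bound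
valid in all three cases. The same power of `x` is split off by the path encoding. -/
theorem le_psWeight_mul_wormRate [Nonempty V] (hx0 : 0 < x) (hx1 : x ≤ 1)
    (hdeg : ∀ v, 0 < G.degree v) {A : Finset (Sym2 V)} {e : Sym2 V} (he : e ∈ G.edgeFinset)
    (hA : A ∈ oddClass G 0 ∪ oddClass G 2) (hA' : symmDiff A {e} ∈ oddClass G 0 ∪ oddClass G 2) :
    x ^ #(insert e A) / (2 * G.maxDegree) ≤ psWeight G x A * wormRate G x A e := by
  have hd : ∀ v, (0 : ℝ) < G.degree v := fun v => Nat.cast_pos.2 (hdeg v)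
  have hle : ∀ v, (G.degree v : ℝ) ≤ G.maxDegree := fun v => Nat.cast_le.2 (G.degree_le_maxDegree v)
  have hone : x ^ #(insert e A) / (2 * G.maxDegree) ≤
      x ^ #(insert e A) * (1 / 2) * ∑ w ∈ e.toFinset, 1 / (G.degree w : ℝ) := by
    obtain ⟨w, hw⟩ : e.toFinset.Nonempty := by
      rw [← card_pos, Sym2.card_toFinset_of_not_isDiag e (G.not_isDiag_of_mem_edgeFinset he)]
      norm_num
    have h1 : 1 / (G.maxDegree : ℝ) ≤ ∑ w ∈ e.toFinset, 1 / (G.degree w : ℝ) :=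
      (one_div_le_one_div_of_le (hd w) (hle w)).trans
        (single_le_sum (f := fun w => 1 / (G.degree w : ℝ)) (fun v _ => by positivity) hw)
    calc x ^ #(insert e A) / (2 * G.maxDegree)
        = x ^ #(insert e A) * (1 / 2) * (1 / (G.maxDegree : ℝ)) := by ring
      _ ≤ _ := mul_le_mul_of_nonneg_left h1 (by positivity)
  by_cases h0 : A ∈ oddClass G 0
  · rwa [psWeight_mul_wormRate_of_left h0]
  have h2 := (mem_union.1 hA).resolve_left h0
  by_cases h0' : symmDiff A {e} ∈ oddClass G 0
  · rwa [psWeight_mul_wormRate_of_right h0 h0']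
  have h2' := (mem_union.1 hA').resolve_left h0'
  obtain ⟨hu, hv⟩ := card_inter_and_sdiff_of_two he h2 h2'
  obtain ⟨u, hu⟩ := card_eq_one.1 hu
  obtain ⟨v, hv⟩ := card_eq_one.1 hv
  rw [psWeight_mul_wormRate_of_two hx0 hdeg h2 h2', hu, hv, sum_singleton, sum_singleton,
    mul_comm (2 : ℝ), ← div_div]
  refine div_le_div_of_nonneg_right (le_min ?_ ?_) (by norm_num)
  · exact div_le_div₀ (by positivity) (pow_le_pow_of_le_one hx0.le hx1
      (card_le_card (symmDiff_singleton_subset_insert A e))) (hd v) (hle v)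
  · exact div_le_div₀ (by positivity) (pow_le_pow_of_le_one hx0.le hx1
      (card_le_card (subset_insert e A))) (hd u) (hle u)

/-- Double counting: a vertex `u` of `S` lies on `d(u)` edges. With `S` all vertices or `∂A`, this
yields holding probability at least `1/2`. -/
theorem sum_edge_sum_inv_degree (hdeg : ∀ v, 0 < G.degree v) (S : Finset V) :
    ∑ e ∈ G.edgeFinset, ∑ u ∈ e.toFinset ∩ S, 1 / (G.degree u : ℝ) = #S := by
  have h1 : ∀ e : Sym2 V, ∑ u ∈ e.toFinset ∩ S, 1 / (G.degree u : ℝ) =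
      ∑ u ∈ S, if u ∈ e then 1 / (G.degree u : ℝ) else 0 := by
    intro e
    rw [← sum_filter]
    refine sum_congr ?_ fun _ _ => rfl
    ext u
    simp [and_comm]
  simp_rw [h1]
  rw [sum_comm, card_eq_sum_ones, Nat.cast_sum]
  refine sum_congr rfl fun u _ => ?_
  have hu : (G.degree u : ℝ) ≠ 0 := Nat.cast_ne_zero.2 (hdeg u).ne'
  rw [← sum_filter, sum_const, ← G.incidenceFinset_eq_filter, G.card_incidenceFinset_eq_degree,
    nsmul_eq_mul, mul_one_div_cancel hu, Nat.cast_one]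

theorem wormRate_le_of_two (hx1 : x ≤ 1) {A : Finset (Sym2 V)} {e : Sym2 V}
    (he : e ∈ G.edgeFinset) (hA : A ∈ oddClass G 2) :
    wormRate G x A e ≤ (1 / 4) * ∑ u ∈ e.toFinset ∩ oddVertices A, 1 / (G.degree u : ℝ) := by
  have hsum : ∀ S : Finset V, 0 ≤ ∑ u ∈ S, 1 / (G.degree u : ℝ) :=
    fun S => sum_nonneg fun _ _ => by positivity
  rw [wormRate, if_neg (disjoint_right.1 (disjoint_oddClass G) hA)]
  by_cases h0 : symmDiff A {e} ∈ oddClass G 0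
  · have h1 : e.toFinset ∩ oddVertices A = e.toFinset := by
      have h4 := card_eq_zero.1 ((mem_oddClass G).1 h0).2
      rw [oddVertices_symmDiff_singleton G he, ← bot_eq_empty, symmDiff_eq_bot] at h4
      rw [h4, inter_self]
    rw [if_pos h0, h1]
    refine mul_le_mul_of_nonneg_right ?_ (hsum _)
    split_ifs <;> linarith
  rw [if_neg h0]
  by_cases h2 : A ∈ oddClass G 2 ∧ symmDiff A {e} ∈ oddClass G 2
  · obtain ⟨v, hv⟩ := card_eq_one.1 (card_inter_and_sdiff_of_two he hA h2.2).2
    rw [if_pos h2, mul_sum]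
    simp_rw [hv, sum_singleton]
    refine sum_le_sum fun u _ => ?_
    refine (mul_le_mul_of_nonneg_right (min_le_right _ _) (by positivity)).trans (le_of_eq ?_)
    rw [one_mul, one_div_mul_one_div]
  · rw [if_neg h2]
    exact mul_nonneg (by norm_num) (hsum _)

theorem sum_wormRate_le [Nonempty V] (hx1 : x ≤ 1) (hdeg : ∀ v, 0 < G.degree v)
    {A : Finset (Sym2 V)} (hA : A ∈ oddClass G 0 ∪ oddClass G 2) :
    ∑ e ∈ G.edgeFinset, wormRate G x A e ≤ 1 / 2 := by
  have hn : (0 : ℝ) < Fintype.card V := Nat.cast_pos.2 Fintype.card_pos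
  rcases mem_union.1 hA with h0 | h2
  · have hle : ∀ e ∈ G.edgeFinset, wormRate G x A e ≤
        1 / (2 * Fintype.card V) * ∑ w ∈ e.toFinset ∩ univ, 1 / (G.degree w : ℝ) := by
      intro e _
      rw [wormRate, if_pos h0, inter_univ]
      refine mul_le_mul_of_nonneg_right ?_ (sum_nonneg fun _ _ => by positivity)
      refine mul_le_of_le_one_left (by positivity) ?_
      split_ifs <;> linarith
    refine (sum_le_sum hle).trans (le_of_eq ?_)
    rw [← mul_sum, sum_edge_sum_inv_degree hdeg, card_univ]
    field_simp
  · refine (sum_le_sum fun e he => wormRate_le_of_two hx1 he h2).trans (le_of_eq ?_)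
    rw [← mul_sum, sum_edge_sum_inv_degree hdeg, ((mem_oddClass G).1 h2).2]
    norm_num

/-- Summation over the states that can be reached in one step. -/
theorem sum_wormState_sum_edge (A : Finset (Sym2 V)) (h : Finset (Sym2 V) → Sym2 V → ℝ) :
    ∑ B : WormState G, ∑ e ∈ G.edgeFinset with symmDiff A {e} = B.1, h B.1 e =
      ∑ e ∈ G.edgeFinset with symmDiff A {e} ∈ oddClass G 0 ∪ oddClass G 2,
        h (symmDiff A {e}) e := by
  rw [sum_wormState G fun B => ∑ e ∈ G.edgeFinset with symmDiff A {e} = B, h B e]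
  simp_rw [sum_filter]
  rw [sum_comm]
  refine sum_congr rfl fun e _ => ?_
  rw [sum_ite_eq]

theorem wormOffDiag_nonneg (hx0 : 0 < x) (A B : WormState G) : 0 ≤ wormOffDiag G x A B :=
  sum_nonneg fun _ _ => wormRate_nonneg hx0 _ _

theorem sum_wormOffDiag_le [Nonempty V] (hx0 : 0 < x) (hx1 : x ≤ 1)
    (hdeg : ∀ v, 0 < G.degree v) (A : WormState G) :
    ∑ B ∈ univ.erase A, wormOffDiag G x A B ≤ 1 / 2 :=
  calc ∑ B ∈ univ.erase A, wormOffDiag G x A B ≤ ∑ B, wormOffDiag G x A B :=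
        sum_le_sum_of_subset_of_nonneg (erase_subset _ _) fun B _ _ => wormOffDiag_nonneg hx0 A B
    _ = ∑ e ∈ G.edgeFinset with symmDiff A.1 {e} ∈ oddClass G 0 ∪ oddClass G 2,
        wormRate G x A.1 e := sum_wormState_sum_edge A.1 fun _ e => wormRate G x A.1 e
    _ ≤ ∑ e ∈ G.edgeFinset, wormRate G x A.1 e :=
        sum_le_sum_of_subset_of_nonneg (filter_subset _ _) fun _ _ _ => wormRate_nonneg hx0 _ _
    _ ≤ 1 / 2 := sum_wormRate_le hx1 hdeg A.2

theorem psMeasure_mul_wormOffDiag [Nonempty V] (hx0 : 0 < x) (hdeg : ∀ v, 0 < G.degree v)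
    (A B : WormState G) :
    psMeasure G x A * wormOffDiag G x A B = psMeasure G x B * wormOffDiag G x B A := by
  have hcomm : ∀ e : Sym2 V, symmDiff A.1 {e} = B.1 ↔ symmDiff B.1 {e} = A.1 := by
    intro e
    constructor <;> intro h <;> rw [← h, symmDiff_symmDiff_cancel_right]
  simp only [wormOffDiag, mul_sum, psMeasure_eq]
  simp_rw [← hcomm]
  refine sum_congr rfl fun e he => ?_
  obtain ⟨he, hAB⟩ := mem_filter.1 he
  have hB := B.2
  rw [← hAB] at hB ⊢
  have := psWeight_mul_wormRate_symm hx0 hdeg he A.2 hB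
  rw [div_mul_eq_mul_div, div_mul_eq_mul_div, this]

theorem wormMatrix_isLazyReversible [Nonempty V] (hx0 : 0 < x) (hx1 : x ≤ 1)
    (hdeg : ∀ v, 0 < G.degree v) : IsLazyReversible (wormMatrix G x) (psMeasure G x) where
  pos := psMeasure_pos hx0
  sum_eq_one := sum_psMeasure hx0
  row_sum A := by
    rw [← add_sum_erase _ _ (mem_univ A)]
    have : ∑ B ∈ univ.erase A, wormMatrix G x A B = ∑ B ∈ univ.erase A, wormOffDiag G x A B :=
      sum_congr rfl fun B hB => if_neg (ne_of_mem_erase hB).symm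
    rw [this, wormMatrix, if_pos rfl]
    ring
  nonneg A B := by
    rw [wormMatrix]
    split_ifs
    · linarith [sum_wormOffDiag_le hx0 hx1 hdeg A]
    · exact wormOffDiag_nonneg hx0 A B
  lazy A := by
    rw [wormMatrix, if_pos rfl]
    linarith [sum_wormOffDiag_le hx0 hx1 hdeg A]
  reversible A B := by
    by_cases h : A = B
    · rw [h]
    · rw [wormMatrix, wormMatrix, if_neg h, if_neg (Ne.symm h), psMeasure_mul_wormOffDiag hx0 hdeg]

end WormChain

/-! ### The Poincaré inequality for the worm process -/

section Poincare

/-- Put `C = F ∆ D'`. Off `D`, all of `F`, `F ∆ D`, `C` and `D ∆ C` agree; inside `D`, each of the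
pairs `F, F ∆ D` and `C, D ∆ C` is complementary. Both sides count `2|F \ D| + |D|`. -/
theorem card_symmDiff_add_card {α : Type*} [DecidableEq α] (F : Finset α) {D D' : Finset α}
    (h : D' ⊆ D) :
    #(symmDiff F D) + #F = #(symmDiff F D') + #(symmDiff D (symmDiff F D')) := by
  have h1 : D ∩ symmDiff F D' = symmDiff (F ∩ D) D' := by
    ext a
    have := @h a
    simp only [mem_inter, mem_symmDiff]
    tauto
  have h2 : F ∩ D ∩ D' = F ∩ D' := by
    rw [inter_assoc, inter_eq_right.2 h]
  have h3 := card_symmDiff_add_two_mul_card_inter F D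
  have h4 := card_symmDiff_add_two_mul_card_inter F D'
  have h5 := card_symmDiff_add_two_mul_card_inter D (symmDiff F D')
  have h6 := card_symmDiff_add_two_mul_card_inter (F ∩ D) D'
  rw [h1] at h5
  rw [h2] at h6
  omega

theorem symmDiff_erase {α : Type*} [DecidableEq α] (F : Finset α) {S : Finset α} {e : α}
    (he : e ∈ S) : symmDiff F (S.erase e) = symmDiff (symmDiff F S) {e} := by
  ext a
  simp only [mem_symmDiff, mem_erase, mem_singleton]
  by_cases h : a = e
  · subst h; tauto
  · tauto

/-- The set `insert e (F ∆ S)` is the larger end of the step that flips `e`, and either end is `F ∆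
D'` for some `D' ⊆ D`. -/
theorem card_symmDiff_add_card_insert {α : Type*} [DecidableEq α] (F : Finset α)
    {D S : Finset α} (h : S ⊆ D) {e : α} (he : e ∈ S) :
    #(symmDiff F D) + #F = #(insert e (symmDiff F S)) +
      #(symmDiff D (insert e (symmDiff F S))) := by
  by_cases hF : e ∈ symmDiff F S
  · rw [insert_eq_of_mem hF]
    exact card_symmDiff_add_card F h
  · rw [← symmDiff_singleton_of_notMem _ e hF, ← symmDiff_erase F he]
    exact card_symmDiff_add_card F ((erase_subset e S).trans h)

variable {V : Type*} [Fintype V] [DecidableEq V] {G : SimpleGraph V} [DecidableRel G.Adj] {x : ℝ}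

theorem oddVertices_symmDiff_of_even {F : Finset (Sym2 V)} (hF : F ∈ oddClass G 0)
    (D : Finset (Sym2 V)) : oddVertices (symmDiff F D) = oddVertices D := by
  rw [oddVertices_symmDiff, card_eq_zero.1 ((mem_oddClass G).1 hF).2, ← bot_eq_empty, bot_symmDiff]

theorem symmDiff_mem_oddClass {F : Finset (Sym2 V)} (hF : F ∈ oddClass G 0) {k : ℕ}
    {D : Finset (Sym2 V)} : symmDiff F D ∈ oddClass G k ↔ D ∈ oddClass G k := by
  have hFE := ((mem_oddClass G).1 hF).1
  rw [mem_oddClass, mem_oddClass, oddVertices_symmDiff_of_even hF]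
  refine and_congr_left fun _ => ⟨fun h => ?_, fun h => symmDiff_le_sup.trans (sup_le hFE h)⟩
  rw [← symmDiff_symmDiff_cancel_left F D]
  exact symmDiff_le_sup.trans (sup_le hFE h)

theorem symmDiff_mem_wormState {F : Finset (Sym2 V)} (hF : F ∈ oddClass G 0)
    {D : Finset (Sym2 V)} :
    symmDiff F D ∈ oddClass G 0 ∪ oddClass G 2 ↔ D ∈ oddClass G 0 ∪ oddClass G 2 := by
  rw [mem_union, mem_union, symmDiff_mem_oddClass hF, symmDiff_mem_oddClass hF]

theorem psFactor_symmDiff {F : Finset (Sym2 V)} (hF : F ∈ oddClass G 0) (D : Finset (Sym2 V)) :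
    psFactor G (symmDiff F D) = psFactor G D := by
  simp only [psFactor, symmDiff_mem_oddClass hF]

/-- The contribution to the variance of the pairs `(F ∆ D, F)` with a given `D`, bounded by
following the path that removes the edges of `D` one after the other. -/
theorem sum_even_sq_sub_le [Nonempty V] (hx0 : 0 < x) (g : Finset (Sym2 V) → ℝ)
    {D : Finset (Sym2 V)} (hD : D ∈ oddClass G 0 ∪ oddClass G 2) :
    ∑ F ∈ oddClass G 0,
        psWeight G x F * (psWeight G x (symmDiff F D) * (g (symmDiff F D) - g F) ^ 2) ≤
      #G.edgeFinset * Fintype.card V * ∑ A ∈ oddClass G 0 ∪ oddClass G 2,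
        ∑ e ∈ G.edgeFinset with symmDiff A {e} ∈ oddClass G 0 ∪ oddClass G 2,
          (psFactor G D * x ^ #(symmDiff D (insert e A))) *
            (x ^ #(insert e A) * (g A - g (symmDiff A {e})) ^ 2) := by
  have hψ := psFactor_pos (G := G) D
  obtain ⟨hDE, hfew⟩ := (mem_wormState G).1 hD
  obtain ⟨suf, hsuf, htel⟩ := exists_removal_order
    (fun e he => G.not_isDiag_of_mem_edgeFinset (hDE he)) hfew
  set H : Finset (Sym2 V) → Sym2 V → ℝ := fun A e =>
    (psFactor G D * x ^ #(symmDiff D (insert e A))) *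
      (x ^ #(insert e A) * (g A - g (symmDiff A {e})) ^ 2) with hH
  have hH0 : ∀ A e, 0 ≤ H A e := fun A e => by positivity
  have hstep : ∀ F ∈ oddClass G 0,
      psWeight G x F * (psWeight G x (symmDiff F D) * (g (symmDiff F D) - g F) ^ 2) ≤
        #G.edgeFinset * Fintype.card V * ∑ e ∈ D, H (symmDiff F (suf e)) e := by
    intro F hF
    have hsq : (g (symmDiff F D) - g F) ^ 2 ≤ #G.edgeFinset *
        ∑ e ∈ D, (g (symmDiff F (suf e)) - g (symmDiff (symmDiff F (suf e)) {e})) ^ 2 := by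
      rw [htel g F]
      refine sq_sum_le_card_mul_sum_sq.trans ?_
      refine mul_le_mul (Nat.cast_le.2 (card_le_card hDE)) (le_of_eq ?_)
        (sum_nonneg fun _ _ => sq_nonneg _) (Nat.cast_nonneg _)
      exact sum_congr rfl fun e he => by rw [symmDiff_erase F (hsuf e he).1]
    have hw : psWeight G x F * psWeight G x (symmDiff F D) =
        Fintype.card V * (psFactor G D * x ^ (#(symmDiff F D) + #F)) := by
      rw [psWeight, psWeight, psFactor_symmDiff hF, psFactor, if_pos hF, pow_add]
      ring
    rw [← mul_assoc, hw]
    refine (mul_le_mul_of_nonneg_left hsq (by positivity)).trans (le_of_eq ?_)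
    simp only [mul_sum, hH]
    refine sum_congr rfl fun e he => ?_
    rw [card_symmDiff_add_card_insert F (hsuf e he).2.1 (hsuf e he).1, pow_add]
    ring
  refine (sum_le_sum hstep).trans ?_
  rw [← mul_sum]
  refine mul_le_mul_of_nonneg_left ?_ (by positivity)
  rw [sum_comm]
  have hcomm : ∑ A ∈ oddClass G 0 ∪ oddClass G 2,
        ∑ e ∈ G.edgeFinset with symmDiff A {e} ∈ oddClass G 0 ∪ oddClass G 2, H A e =
      ∑ e ∈ G.edgeFinset, ∑ A ∈ oddClass G 0 ∪ oddClass G 2 with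
        symmDiff A {e} ∈ oddClass G 0 ∪ oddClass G 2, H A e := by
    simp_rw [sum_filter]
    rw [sum_comm]
  rw [hcomm]
  refine (sum_le_sum fun e he => ?_).trans
    (sum_le_sum_of_subset_of_nonneg hDE fun e _ _ => sum_nonneg fun A _ => hH0 A e)
  obtain ⟨h1, h2, h3, h4⟩ := hsuf e he
  -- Injectivity of the encoding: for fixed `D` and `e`, `F` is recovered from `A = F ∆ suf e`.
  rw [← sum_image (f := fun A => H A e) (g := fun F => symmDiff F (suf e))
    (fun F _ F' _ h => symmDiff_left_injective _ h)]
  refine sum_le_sum_of_subset_of_nonneg ?_ fun A _ _ => hH0 A e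
  intro A hA
  obtain ⟨F, hF, rfl⟩ := mem_image.1 hA
  rw [mem_filter, ← symmDiff_erase F h1, symmDiff_mem_wormState hF, symmDiff_mem_wormState hF,
    mem_wormState, mem_wormState]
  exact ⟨⟨h2.trans hDE, h3⟩, ((erase_subset _ _).trans h2).trans hDE, h4⟩

/-- After the change of variables `I = F ∆ D`, the sums are exchanged so that `D` is summed for a
fixed transition; this is the congestion bound. -/
theorem sum_pairs_sq_sub_le [Nonempty V] (hx0 : 0 < x) (hx1 : x ≤ 1)
    (g : Finset (Sym2 V) → ℝ) :
    ∑ F ∈ oddClass G 0, psWeight G x F *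
        ∑ I ∈ oddClass G 0 ∪ oddClass G 2, psWeight G x I * (g I - g F) ^ 2 ≤
      #G.edgeFinset * Fintype.card V * (Fintype.card V ^ 2 * edgeWeight x (oddClass G 0)) *
        ∑ A ∈ oddClass G 0 ∪ oddClass G 2,
          ∑ e ∈ G.edgeFinset with symmDiff A {e} ∈ oddClass G 0 ∪ oddClass G 2,
            x ^ #(insert e A) * (g A - g (symmDiff A {e})) ^ 2 := by
  have hreindex : ∀ F ∈ oddClass G 0, psWeight G x F *
      ∑ I ∈ oddClass G 0 ∪ oddClass G 2, psWeight G x I * (g I - g F) ^ 2 =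
      ∑ D ∈ oddClass G 0 ∪ oddClass G 2,
        psWeight G x F * (psWeight G x (symmDiff F D) * (g (symmDiff F D) - g F) ^ 2) := by
    intro F hF
    rw [mul_sum]
    refine sum_nbij' (fun D => symmDiff F D) (fun D => symmDiff F D) ?_ ?_ ?_ ?_ ?_
    · intro D hD; exact (symmDiff_mem_wormState hF).2 hD
    · intro D hD; exact (symmDiff_mem_wormState hF).2 hD
    · intro D _; exact symmDiff_symmDiff_cancel_left F D
    · intro D _; exact symmDiff_symmDiff_cancel_left F D
    · intro D _
      rw [symmDiff_symmDiff_cancel_left]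
  rw [sum_congr rfl hreindex, sum_comm]
  refine (sum_le_sum fun D hD => sum_even_sq_sub_le hx0 g hD).trans ?_
  rw [← mul_sum, mul_assoc _ ((Fintype.card V : ℝ) ^ 2 * _)]
  refine mul_le_mul_of_nonneg_left ?_ (by positivity)
  rw [sum_comm, mul_sum]
  refine sum_le_sum fun A hA => ?_
  rw [sum_comm, mul_sum]
  refine sum_le_sum fun e he => ?_
  rw [← sum_mul]
  refine mul_le_mul_of_nonneg_right ?_ (by positivity)
  exact sum_psFactor_mul_pow_symmDiff_le G hx0.le hx1
    (insert_subset (mem_filter.1 he).1 ((mem_wormState G).1 hA).1)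

theorem wormMatrix_dirichlet (f : WormState G → ℝ) (g : Finset (Sym2 V) → ℝ)
    (hfg : ∀ A, g A.1 = f A) :
    ∑ A, ∑ B, psMeasure G x A * wormMatrix G x A B * (f A - f B) ^ 2 =
      (∑ A ∈ oddClass G 0 ∪ oddClass G 2,
        ∑ e ∈ G.edgeFinset with symmDiff A {e} ∈ oddClass G 0 ∪ oddClass G 2,
          psWeight G x A * wormRate G x A e * (g A - g (symmDiff A {e})) ^ 2) / psTotal G x := by
  rw [← sum_wormState G fun A =>
    ∑ e ∈ G.edgeFinset with symmDiff A {e} ∈ oddClass G 0 ∪ oddClass G 2,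
          psWeight G x A * wormRate G x A e * (g A - g (symmDiff A {e})) ^ 2, sum_div]
  refine sum_congr rfl fun A _ => ?_
  rw [← sum_wormState_sum_edge A.1 fun B e =>
    psWeight G x A.1 * wormRate G x A.1 e * (g A.1 - g B) ^ 2, sum_div]
  refine sum_congr rfl fun B _ => ?_
  have h : wormMatrix G x A B * (f A - f B) ^ 2 = wormOffDiag G x A B * (f A - f B) ^ 2 := by
    by_cases hAB : A = B
    · simp [hAB]
    · rw [wormMatrix, if_neg hAB]
  rw [mul_assoc, h, hfg, hfg, psMeasure_eq, wormOffDiag, sum_mul, mul_sum, sum_div]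
  exact sum_congr rfl fun e _ => by ring

theorem wormMatrix_poincare [Nonempty V] (hx0 : 0 < x) (hx1 : x ≤ 1)
    (hdeg : ∀ v, 0 < G.degree v) :
    PoincareInequality (wormMatrix G x) (psMeasure G x)
      (4 * G.maxDegree * #G.edgeFinset * (Fintype.card V : ℝ) ^ 2) := by
  intro f hf
  -- An extension of `f` by `0` to all sets of edges, so that flips and translations need no
  -- membership proofs.
  set g : Finset (Sym2 V) → ℝ := fun A =>
    if h : A ∈ oddClass G 0 ∪ oddClass G 2 then f ⟨A, h⟩ else 0 with hg
  have hfg : ∀ A : WormState G, g A.1 = f A := fun A => dif_pos A.2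
  have hZ : 0 < psTotal G x := psTotal_pos hx0
  have hn : (0 : ℝ) < Fintype.card V := Nat.cast_pos.2 Fintype.card_pos
  have hl : 0 < edgeWeight x (oddClass G 0) := one_pos.trans_le (one_le_edgeWeight_zero hx0)
  have hΔ : (0 : ℝ) < G.maxDegree := Nat.cast_pos.2
    ((hdeg (Classical.arbitrary V)).trans_le (G.degree_le_maxDegree _))
  rw [wormMatrix_dirichlet f g hfg]
  set N : ℝ := ∑ I ∈ oddClass G 0 ∪ oddClass G 2, psWeight G x I * g I ^ 2 with hN
  have hnorm : weightedInner (psMeasure G x) f f = N / psTotal G x := by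
    rw [hN, ← sum_wormState G fun I => psWeight G x I * g I ^ 2, sum_div]
    refine sum_congr rfl fun A _ => ?_
    rw [hfg, psMeasure_eq]
    ring
  have hmean : ∑ I ∈ oddClass G 0 ∪ oddClass G 2, psWeight G x I * g I = 0 := by
    rw [← sum_wormState G fun I => psWeight G x I * g I]
    have : ∑ A, psMeasure G x A * f A = (∑ A : WormState G, psWeight G x A.1 * g A.1) /
        psTotal G x := by
      rw [sum_div]
      refine sum_congr rfl fun A _ => ?_
      rw [hfg, psMeasure_eq]
      ring
    rw [this, div_eq_zero_iff] at hf
    exact hf.resolve_right hZ.ne'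
  -- The mean minimizes the second moment, and here the mean is `0`.
  have hvar : ∀ c : ℝ, N ≤
      ∑ I ∈ oddClass G 0 ∪ oddClass G 2, psWeight G x I * (g I - c) ^ 2 := by
    intro c
    have h1 : ∑ I ∈ oddClass G 0 ∪ oddClass G 2, psWeight G x I * (g I - c) ^ 2 =
        N - 2 * c * ∑ I ∈ oddClass G 0 ∪ oddClass G 2, psWeight G x I * g I +
          c ^ 2 * ∑ I ∈ oddClass G 0 ∪ oddClass G 2, psWeight G x I := by
      rw [hN, mul_sum, mul_sum, ← sum_sub_distrib, ← sum_add_distrib]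
      exact sum_congr rfl fun _ _ => by ring
    rw [h1, hmean, sum_psWeight]
    have : 0 ≤ c ^ 2 * psTotal G x := by positivity
    linarith
  have heven : ∑ F ∈ oddClass G 0, psWeight G x F =
      Fintype.card V * edgeWeight x (oddClass G 0) := by
    rw [edgeWeight, mul_sum]
    exact sum_congr rfl fun F hF => by rw [psWeight, psFactor, if_pos hF, mul_comm]
  have hpairs := (sum_le_sum fun F (_ : F ∈ oddClass G 0) =>
    mul_le_mul_of_nonneg_left (hvar (g F)) (psWeight_pos (G := G) hx0 F).le).trans
      (sum_pairs_sq_sub_le hx0 hx1 g)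
  rw [← sum_mul, heven] at hpairs
  set S₁ := ∑ A ∈ oddClass G 0 ∪ oddClass G 2,
    ∑ e ∈ G.edgeFinset with symmDiff A {e} ∈ oddClass G 0 ∪ oddClass G 2,
      x ^ #(insert e A) * (g A - g (symmDiff A {e})) ^ 2 with hS₁
  set S₂ := ∑ A ∈ oddClass G 0 ∪ oddClass G 2,
    ∑ e ∈ G.edgeFinset with symmDiff A {e} ∈ oddClass G 0 ∪ oddClass G 2,
      psWeight G x A * wormRate G x A e * (g A - g (symmDiff A {e})) ^ 2 with hS₂
  have hflow : S₁ ≤ 2 * G.maxDegree * S₂ := by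
    rw [hS₁, hS₂, mul_sum]
    refine sum_le_sum fun A hA => ?_
    rw [mul_sum]
    refine sum_le_sum fun e he => ?_
    obtain ⟨he, hA'⟩ := mem_filter.1 he
    rw [← mul_assoc]
    refine mul_le_mul_of_nonneg_right ?_ (sq_nonneg _)
    have := le_psWeight_mul_wormRate hx0 hx1 hdeg he hA hA'
    rwa [div_le_iff₀' (by positivity)] at this
  -- The total even weight `n λ(𝒞₀)` appears on both sides of `hpairs` and cancels, taking one of
  -- the three factors `n` with it.
  have hfin : N ≤ #G.edgeFinset * (Fintype.card V : ℝ) ^ 2 * S₁ := by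
    refine le_of_mul_le_mul_left (hpairs.trans (le_of_eq ?_))
      (mul_pos hn hl)
    ring
  rw [hnorm, mul_div_assoc', mul_div_assoc']
  refine div_le_div_of_nonneg_right (hfin.trans ?_) hZ.le
  refine (mul_le_mul_of_nonneg_left hflow (by positivity)).trans (le_of_eq ?_)
  ring

end Poincare

/-! ### Mixing times of the worm process -/

section WormMixing

theorem PoincareInequality.mono {Ω : Type*} [Fintype Ω] {P : Matrix Ω Ω ℝ} {π : Ω → ℝ} {R R' : ℝ}
    (h : IsLazyReversible P π) (hP : PoincareInequality P π R) (hR : R ≤ R') :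
    PoincareInequality P π R' := fun f hf =>
  (hP f hf).trans (mul_le_mul_of_nonneg_right hR (mul_nonneg (by norm_num)
    (sum_nonneg fun ω _ => sum_nonneg fun ω' _ =>
      mul_nonneg (mul_nonneg (h.pos ω).le (h.nonneg ω ω')) (sq_nonneg _))))

theorem IsLazyReversible.mixingTime_le {Ω : Type*} [Fintype Ω] [DecidableEq Ω]
    {P : Matrix Ω Ω ℝ} {π : Ω → ℝ} (h : IsLazyReversible P π) {R : ℝ} (hR : 1 < R)
    (hP : PoincareInequality P π R) {δ T : ℝ} (hδ : 0 < δ) (hT0 : 0 ≤ T)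
    (hT : ∀ ω, R * (Real.log δ⁻¹ + 1 / 2 * Real.log (1 / π ω)) + 1 ≤ T) :
    (mixingTime P π δ : ℝ) ≤ T := by
  refine le_trans (Nat.cast_le.2 (Finset.sup_le fun ω _ => ?_)) (Nat.floor_le hT0)
  exact Nat.le_floor (h.mixingTimeFrom_le hR hP ω hδ hT0 (hT ω))

theorem card_le_two_mul_card_edgeFinset {V : Type*} [Fintype V] {G : SimpleGraph V}
    [DecidableRel G.Adj] (hdeg : ∀ v, 0 < G.degree v) :
    Fintype.card V ≤ 2 * #G.edgeFinset := by
  rw [← G.sum_degrees_eq_twice_card_edges, ← card_univ, card_eq_sum_ones]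
  exact sum_le_sum fun v _ => hdeg v

variable {V : Type*} [Fintype V] [DecidableEq V] {G : SimpleGraph V} [DecidableRel G.Adj] {x : ℝ}

theorem psTotal_le (hx0 : 0 < x) (hx1 : x ≤ 1) (hn : 2 ≤ Fintype.card V) :
    psTotal G x ≤ Fintype.card V * 2 ^ #G.edgeFinset := by
  have hn' : (2 : ℝ) ≤ Fintype.card V := by exact_mod_cast hn
  rw [← sum_psWeight]
  have h1 : ∀ A ∈ oddClass G 0 ∪ oddClass G 2, psWeight G x A ≤ Fintype.card V := by
    intro A _
    have hψ : psFactor G A ≤ Fintype.card V := by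
      rw [psFactor]
      split_ifs
      · exact le_rfl
      · exact hn'
    have hψ0 : 0 ≤ psFactor G A := by
      rw [psFactor]
      split_ifs <;> positivity
    exact (mul_le_of_le_one_left hψ0 (pow_le_one₀ hx0.le hx1)).trans hψ
  have h2 : #(oddClass G 0 ∪ oddClass G 2) ≤ 2 ^ #G.edgeFinset := by
    rw [← card_powerset]
    exact card_le_card fun A hA => mem_powerset.2 ((mem_wormState G).1 hA).1
  refine (sum_le_card_nsmul _ _ _ h1).trans ?_
  rw [nsmul_eq_mul, mul_comm]
  refine mul_le_mul_of_nonneg_left ?_ (by positivity)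
  exact_mod_cast h2

theorem log_inv_psMeasure_emptyState_le (hx0 : 0 < x) (hx1 : x ≤ 1) (hn : 2 ≤ Fintype.card V) :
    Real.log (1 / psMeasure G x (emptyState G)) ≤ #G.edgeFinset * Real.log 2 := by
  have : Nonempty V := Fintype.card_pos_iff.1 (by omega)
  have hn' : (0 : ℝ) < Fintype.card V := Nat.cast_pos.2 (by omega)
  have hmem : (∅ : Finset (Sym2 V)) ∈ oddClass G 0 := by simp [mem_oddClass]
  have hπ : 1 / psMeasure G x (emptyState G) = psTotal G x / Fintype.card V := by
    rw [psMeasure_eq, one_div_div, emptyState, psWeight, psFactor, if_pos hmem]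
    simp
  rw [← Real.log_pow]
  refine Real.log_le_log (one_div_pos.2 (psMeasure_pos hx0 _)) ?_
  rw [hπ, div_le_iff₀' hn']
  exact psTotal_le hx0 hx1 hn

/-- The normalization is at most `n 2^m ≤ 2 · 4^m`, using `n ≤ 2m`, and every state has weight at
least `2 x^m`; the ratio is at most `(4 / x)^m`. -/
theorem log_inv_psMeasure_le (hx0 : 0 < x) (hx1 : x ≤ 1) (hn : 2 ≤ Fintype.card V)
    (hdeg : ∀ v, 0 < G.degree v) (A : WormState G) :
    Real.log (1 / psMeasure G x A) ≤ #G.edgeFinset * (Real.log 2 + Real.log (2 / x)) := by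
  have : Nonempty V := Fintype.card_pos_iff.1 (by omega)
  have hn' : (2 : ℝ) ≤ Fintype.card V := by exact_mod_cast hn
  set m := #G.edgeFinset with hm
  have hw : 2 * x ^ m ≤ psWeight G x A.1 := by
    have hψ : 2 ≤ psFactor G A.1 := by
      rw [psFactor]
      split_ifs
      · exact hn'
      · exact le_rfl
    rw [psWeight, mul_comm]
    exact mul_le_mul (pow_le_pow_of_le_one hx0.le hx1
      (card_le_card ((mem_wormState G).1 A.2).1)) hψ (by norm_num) (by positivity)
  have hcard : (Fintype.card V : ℝ) ≤ 2 * 2 ^ m := by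
    have h1 := card_le_two_mul_card_edgeFinset hdeg
    have h2 : m < 2 ^ m := Nat.lt_two_pow_self
    have h3 : Fintype.card V ≤ 2 * 2 ^ m := by omega
    exact_mod_cast h3
  have hlog : (m : ℝ) * (Real.log 2 + Real.log (2 / x)) = Real.log (2 ^ m * (2 / x) ^ m) := by
    rw [Real.log_mul (by positivity) (by positivity), Real.log_pow, Real.log_pow]
    ring
  rw [hlog]
  refine Real.log_le_log (one_div_pos.2 (psMeasure_pos hx0 _)) ?_
  rw [psMeasure_eq, one_div_div]
  calc psTotal G x / psWeight G x A.1 ≤ (2 * 2 ^ m * 2 ^ m) / (2 * x ^ m) :=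
        div_le_div₀ (by positivity) ((psTotal_le hx0 hx1 hn).trans
          (mul_le_mul_of_nonneg_right hcard (by positivity))) (by positivity) hw
    _ = 2 ^ m * (2 / x) ^ m := by
        rw [div_pow]
        field_simp

end WormMixing

theorem theorem2 {V : Type*} [Fintype V] [DecidableEq V] (G : SimpleGraph V) [DecidableRel G.Adj]
    (hconn : G.Connected) (n m Δ : ℕ) (hn : n = Fintype.card V) (hm : m = #G.edgeFinset)
    (hΔ : Δ = G.maxDegree) (hm1 : 1 ≤ m) (β x : ℝ) (hβ : 0 < β) (hx : x = Real.tanh β) :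
    (lambdaStar (wormMatrix G x) < 1 ∧
      relaxationTime (wormMatrix G x) ≤ 4 * (Δ : ℝ) * m * (n : ℝ) ^ 4) ∧
    ∀ δ : ℝ, 0 < δ → δ < 1 →
      (∀ A, (mixedTimes (wormMatrix G x) (psMeasure G x) A δ).Nonempty) ∧
      (mixingTimeFrom (wormMatrix G x) (psMeasure G x) (emptyState G) δ : ℝ) ≤
        4 * (Real.log 2 + Real.log δ⁻¹ / m) * Δ * (m : ℝ) ^ 2 * (n : ℝ) ^ 4 ∧
      (mixingTime (wormMatrix G x) (psMeasure G x) δ : ℝ) ≤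
        4 * (Real.log (2 / x) + Real.log (2 * δ⁻¹) / m) * Δ * (m : ℝ) ^ 2 * (n : ℝ) ^ 4 := by
  have hx0 : 0 < x := by
    rw [hx, Real.tanh_eq_sinh_div_cosh]
    exact div_pos (Real.sinh_pos_iff.2 hβ) (Real.cosh_pos β)
  have hx1 : x ≤ 1 := hx ▸ (Real.tanh_lt_one β).le
  have hnontriv : Nontrivial V := by
    obtain ⟨e, he⟩ := card_pos.1 (hm ▸ hm1 : 0 < #G.edgeFinset)
    induction e with | _ a b
    exact ⟨a, b, (SimpleGraph.mem_edgeFinset.1 he : G.Adj a b).ne⟩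
  -- Connectedness enters only here, through positive degrees.
  have hdeg : ∀ v, 0 < G.degree v := fun v => hconn.preconnected.degree_pos_of_nontrivial v
  have hcard : 2 ≤ Fintype.card V := Fintype.one_lt_card
  have hΔ1 : 1 ≤ Δ := hΔ ▸ (hdeg (Classical.arbitrary V)).trans_le (G.degree_le_maxDegree _)
  have hlazy := wormMatrix_isLazyReversible hx0 hx1 hdeg
  set R : ℝ := 4 * (Δ : ℝ) * m * (n : ℝ) ^ 4 with hR
  have hn1 : (1 : ℝ) ≤ n := by
    rw [hn]
    exact_mod_cast (by omega : 1 ≤ Fintype.card V)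
  have hm1' : (1 : ℝ) ≤ m := by exact_mod_cast hm1
  have hΔ1' : (1 : ℝ) ≤ Δ := by exact_mod_cast hΔ1
  have hR4 : 4 ≤ R := by
    have h1 : 1 ≤ (Δ : ℝ) * m * (n : ℝ) ^ 4 :=
      one_le_mul_of_one_le_of_one_le (one_le_mul_of_one_le_of_one_le hΔ1' hm1')
        (one_le_pow₀ hn1)
    rw [hR]
    linarith
  have hP : PoincareInequality (wormMatrix G x) (psMeasure G x) R := by
    refine (wormMatrix_poincare hx0 hx1 hdeg).mono hlazy ?_
    rw [← hΔ, ← hm, ← hn, hR]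
    exact mul_le_mul_of_nonneg_left (pow_le_pow_right₀ hn1 (by norm_num)) (by positivity)
  have hR1 : 1 < R := by linarith
  have hgap := hlazy.lambdaStar_le hR1.le hP
  have hRinv : 0 < 1 / R := by positivity
  have hlog2 : 1 / 2 < Real.log 2 := by linarith [Real.log_two_gt_d9]
  refine ⟨⟨by linarith, ?_⟩, fun δ hδ hδ1 => ⟨fun A => ?_, ?_, ?_⟩⟩
  · rw [relaxationTime, one_div_le (by linarith) (by linarith)]
    linarith
  · exact ⟨_, hlazy.mem_mixedTimes hR1 hP A hδ (Nat.le_ceil _)⟩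
  all_goals have hδlog : 0 ≤ Real.log δ⁻¹ := Real.log_nonneg ((one_le_inv₀ hδ).2 hδ1.le)
  · have hT : 4 * (Real.log 2 + Real.log δ⁻¹ / m) * Δ * (m : ℝ) ^ 2 * (n : ℝ) ^ 4 =
        R * (m * Real.log 2 + Real.log δ⁻¹) := by
      rw [hR]
      field_simp
    rw [hT]
    refine hlazy.mixingTimeFrom_le hR1 hP _ hδ (by positivity) ?_
    have h1 := log_inv_psMeasure_emptyState_le (G := G) hx0 hx1 hcard
    rw [← hm] at h1
    -- Only half of `m log 2` is needed, and the other half exceeds `1/4`. Since `R ≥ 4`, this slack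
    -- covers the `+ 1` from rounding.
    have h2 : Real.log δ⁻¹ + 1 / 2 * Real.log (1 / psMeasure G x (emptyState G)) + 1 / 4 ≤
        m * Real.log 2 + Real.log δ⁻¹ := by nlinarith
    have h3 := mul_le_mul_of_nonneg_left h2 (by linarith : 0 ≤ R)
    linarith
  · have hT : 4 * (Real.log (2 / x) + Real.log (2 * δ⁻¹) / m) * Δ * (m : ℝ) ^ 2 * (n : ℝ) ^ 4 =
        R * (m * Real.log (2 / x) + (Real.log 2 + Real.log δ⁻¹)) := by
      rw [hR, Real.log_mul (by norm_num) (by positivity)]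
      field_simp
    rw [hT]
    have hx2 : Real.log 2 ≤ Real.log (2 / x) :=
      Real.log_le_log (by norm_num) (le_div_self (by norm_num) hx0 hx1)
    have hx3 : 0 ≤ Real.log (2 / x) := by linarith
    refine hlazy.mixingTime_le hR1 hP hδ (by positivity) fun A => ?_
    have h1 := log_inv_psMeasure_le hx0 hx1 hcard hdeg A
    rw [← hm] at h1
    -- Half of `m (log 2 + log (2/x))` is at most `m log (2/x)`, since `x ≤ 1`; the extra `log 2`
    -- supplies the `1/4` for rounding.
    have h2 : Real.log δ⁻¹ + 1 / 2 * Real.log (1 / psMeasure G x A) + 1 / 4 ≤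
        m * Real.log (2 / x) + (Real.log 2 + Real.log δ⁻¹) := by nlinarith
    have h3 := mul_le_mul_of_nonneg_left h2 (by linarith : 0 ≤ R)
    linarith
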